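/- Let $K$ be an algebraically closed field, let $Q$ be a finite, connected and acyclic quiver with $n$ vertices, and let $A=KQ$ be its path algebra. All modules below are finitely generated right $A$-modules. Let $X=\{X_i\}_{i=1}^{t}$ be a stratifying system of size $t$ over $A$, that is, a family of indecomposable $A$-modules with $\operatorname{Hom}_A(X_j,X_i)=0$ for $j>i$ and $\operatorname{Ext}^1_A(X_j,X_i)=0$ for $j\ge i$. Let $\mathcal F(X)$ be the class of all modules $M$ having a finite chain of submodules $0=M_0\subseteq M_1\subseteq\dots\subseteq M_s=M$ ($s \ge 0$) such that each $M_i/M_{i-1}$ is isomorphic to a module in $X$, and let $\mathcal Y(X)$ be the class of all modules $M$ with $\operatorname{Ext}^1_A(N,M)=0$ for all $N\in\mathcal F(X)$. Then there is a basic partial tilting $A$-module $T$ such that $$\mathcal F(X)\cap\mathcal Y(X)=\operatorname{add}T,$$ and moreover $t\le n$. Here $T$ is partial tilting if $\operatorname{pd}T\le 1$ and $\operatorname{Ext}^1_A(T,T)=0$; it is basic if it is a finite direct sum of pairwise non-isomorphic indecomposable modules; and $\operatorname{add}T$ is the class of all finite direct sums of direct summands of $T$. -/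

import Mathlib

open CategoryTheory CategoryTheory.Limits

universe w v u

/-! ### Quivers and path algebras -/

/-- A quiver is connected if it is non-empty and any two vertices are joined by an
unoriented path. -/
def QuiverConnected (V : Type v) [Quiver.{w} V] : Prop :=
  Nonempty V ∧ ∀ a b : V, Nonempty (@Quiver.Path (Quiver.Symmetrify V) _ a b)

/-- A quiver is acyclic if it has no oriented cycle of positive length. -/
def QuiverAcyclic (V : Type v) [Quiver.{w} V] : Prop :=
  ∀ (a : V) (p : Quiver.Path a a), p.length = 0

/-- All paths of a quiver, each with its source and its target. -/
abbrev QuiverPaths (V : Type v) [Quiver.{w} V] : Type (max v w) :=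
  Σ a : V, Σ b : V, Quiver.Path a b

/-- The path algebra: the vector space with basis the set of all paths. -/
def PathAlgebra (K : Type u) [Field K] (V : Type v) [Quiver.{w} V] : Type (max u v w) :=
  QuiverPaths V →₀ K

namespace PathAlgebra

noncomputable section

variable (K : Type u) [Field K] {V : Type v} [Quiver.{w} V]

instance : AddCommGroup (PathAlgebra K V) := inferInstanceAs (AddCommGroup (QuiverPaths V →₀ K))

instance : Module K (PathAlgebra K V) := inferInstanceAs (Module K (QuiverPaths V →₀ K))

/-- The basis element given by a path. -/
def of (x : QuiverPaths V) : PathAlgebra K V := Finsupp.single x (1 : K)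

open Classical in
/-- The product of two basis elements: the concatenation "first `x`, then `y`" if `x` ends where
`y` starts, and zero otherwise. -/
def pathMul (x y : QuiverPaths V) : PathAlgebra K V :=
  if h : y.1 = x.2.1 then of K ⟨x.1, y.2.1, x.2.2.comp (y.2.2.cast h rfl)⟩ else 0

/-- The bilinear extension of `pathMul`. -/
def mulHom : PathAlgebra K V →ₗ[K] PathAlgebra K V →ₗ[K] PathAlgebra K V :=
  Finsupp.linearCombination K fun x => Finsupp.linearCombination K fun y => pathMul K x y

instance : Mul (PathAlgebra K V) := ⟨fun f g => mulHom K f g⟩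

/-- The identity is the sum of the trivial paths. -/
instance [Fintype V] : One (PathAlgebra K V) := ⟨∑ a : V, of K ⟨a, a, Quiver.Path.nil⟩⟩

theorem mul_def (f g : PathAlgebra K V) : f * g = mulHom K f g := rfl

theorem one_def [Fintype V] :
    (1 : PathAlgebra K V) = ∑ a : V, of K ⟨a, a, Quiver.Path.nil⟩ := rfl

theorem of_mul_of (x y : QuiverPaths V) : of K x * of K y = pathMul K x y := by
  rw [mul_def, mulHom, of, of]
  erw [Finsupp.linearCombination_single, one_smul, Finsupp.linearCombination_single, one_smul]

theorem pathMul_comp {a b c : V} (p : Quiver.Path a b) (q : Quiver.Path b c) :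
    pathMul K ⟨a, b, p⟩ ⟨b, c, q⟩ = of K ⟨a, c, p.comp q⟩ := by
  simp [pathMul]

theorem pathMul_of_ne {x y : QuiverPaths V} (h : y.1 ≠ x.2.1) : pathMul K x y = 0 := by
  simp [pathMul, h]

theorem lin_ext {M : Type*} [AddCommGroup M] [Module K M] {f g : PathAlgebra K V →ₗ[K] M}
    (h : ∀ x, f (of K x) = g (of K x)) : f = g :=
  Finsupp.lhom_ext' fun x => LinearMap.ext_ring (h x)

theorem pathMul_assoc (x y z : QuiverPaths V) :
    mulHom K (pathMul K x y) (of K z) = mulHom K (of K x) (pathMul K y z) := by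
  obtain ⟨a, b, p⟩ := x
  obtain ⟨b', c, q⟩ := y
  obtain ⟨c', d, r⟩ := z
  by_cases h : b' = b
  · subst h
    by_cases h' : c' = c
    · subst h'
      rw [pathMul_comp, pathMul_comp, ← mul_def, ← mul_def, of_mul_of, of_mul_of, pathMul_comp,
        pathMul_comp, Quiver.Path.comp_assoc]
    · rw [pathMul_comp, ← mul_def, of_mul_of, pathMul_of_ne K (by exact h'),
        pathMul_of_ne K (by exact h'), map_zero]
  · rw [pathMul_of_ne K (by exact h), map_zero, LinearMap.zero_apply]
    by_cases h' : c' = c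
    · subst h'
      rw [pathMul_comp, ← mul_def, of_mul_of, pathMul_of_ne K (by exact h)]
    · rw [pathMul_of_ne K (by exact h'), map_zero]

theorem mulHom_assoc (f g h : PathAlgebra K V) :
    mulHom K (mulHom K f g) h = mulHom K f (mulHom K g h) := by
  have key : (LinearMap.llcomp K _ _ _ (mulHom K (V := V))).comp (mulHom K) =
      ((LinearMap.llcomp K _ _ _).flip (mulHom K (V := V))).comp
        ((LinearMap.llcomp K (PathAlgebra K V) (PathAlgebra K V) (PathAlgebra K V)).comp
          (mulHom K)) := by
    refine lin_ext K fun x => lin_ext K fun y => lin_ext K fun z => ?_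
    have := pathMul_assoc K x y z
    rw [← of_mul_of, ← of_mul_of] at this
    exact this
  exact LinearMap.congr_fun (LinearMap.congr_fun (LinearMap.congr_fun key f) g) h

theorem one_mulHom [Fintype V] (f : PathAlgebra K V) : mulHom K 1 f = f := by
  have key : mulHom K (1 : PathAlgebra K V) = LinearMap.id := by
    refine lin_ext K fun x => ?_
    obtain ⟨a, b, p⟩ := x
    rw [one_def, map_sum, LinearMap.sum_apply, Finset.sum_eq_single a]
    · rw [← mul_def, of_mul_of, pathMul_comp, Quiver.Path.nil_comp]; rfl
    · intro c _ hc
      rw [← mul_def, of_mul_of, pathMul_of_ne K (by exact hc.symm)]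
    · simp
  exact LinearMap.congr_fun key f

theorem mulHom_one [Fintype V] (f : PathAlgebra K V) : mulHom K f 1 = f := by
  have key : (mulHom K).flip (1 : PathAlgebra K V) = LinearMap.id := by
    refine lin_ext K fun x => ?_
    obtain ⟨a, b, p⟩ := x
    rw [LinearMap.flip_apply, one_def, map_sum, Finset.sum_eq_single b]
    · rw [← mul_def, of_mul_of, pathMul_comp, Quiver.Path.comp_nil]; rfl
    · intro c _ hc
      rw [← mul_def, of_mul_of, pathMul_of_ne K (by exact hc)]
    · simp
  exact LinearMap.congr_fun key f

instance [Fintype V] : Ring (PathAlgebra K V) :=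
  { (inferInstance : AddCommGroup (PathAlgebra K V)) with
    mul := (· * ·)
    one := 1
    mul_assoc := mulHom_assoc K
    one_mul := one_mulHom K
    mul_one := mulHom_one K
    left_distrib := fun f g h => map_add (mulHom K f) g h
    right_distrib := fun f g h => LinearMap.map_add₂ (mulHom K) f g h
    zero_mul := fun f => LinearMap.map_zero₂ (mulHom K) f
    mul_zero := fun f => map_zero (mulHom K f) }

instance [Fintype V] : Algebra K (PathAlgebra K V) :=
  Algebra.ofModule (fun r f g => LinearMap.map_smul₂ (mulHom K) r f g)
    (fun r f g => map_smul (mulHom K f) r g)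

end

end PathAlgebra

/-- Right modules over the path algebra, that is, left modules over its opposite. -/
abbrev RightPathModule (K : Type u) [Field K] (V : Type v) [Quiver.{w} V] [Fintype V] :=
  ModuleCat.{max u v w} (PathAlgebra K V)ᵐᵒᵖ

/-! ### Stratifying systems and partial tilting modules over a ring -/

section Modules

variable {R : Type u} [Ring R]

/-- `X 0, …, X (t - 1)` is a stratifying system of size `t`: finitely generated indecomposable
modules with `Hom (X j, X i) = 0` for `j > i` and `Ext¹ (X j, X i) = 0` for `j ≥ i`. -/
structure IsStratifyingSystem {t : ℕ} (X : Fin t → ModuleCat.{u} R) : Prop where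
  finite : ∀ i, Module.Finite R (X i)
  indecomposable : ∀ i, Indecomposable (X i)
  hom_eq_zero : ∀ i j, i < j → ∀ f : X j ⟶ X i, f = 0
  ext_eq_zero : ∀ i j, i ≤ j → Subsingleton (Abelian.Ext (X j) (X i) 1)

/-- `M` belongs to `𝓕(X)`: there is a chain `0 = F 0 ⊆ F 1 ⊆ … ⊆ F s = M` of submodules
such that every quotient `F (i + 1) / F i` is isomorphic to one of the modules `X k`.
(The case `s = 0` is that of the zero module.) -/
def IsFilteredBy {t : ℕ} (X : Fin t → ModuleCat.{u} R) (M : ModuleCat.{u} R) : Prop :=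
  ∃ (s : ℕ) (F : Fin (s + 1) → Submodule R M), Monotone F ∧ F 0 = ⊥ ∧ F (Fin.last s) = ⊤ ∧
    ∀ i : Fin s, ∃ k : Fin t,
      Nonempty ((F i.succ ⧸ (F i.castSucc).submoduleOf (F i.succ)) ≃ₗ[R] X k)

/-- `M` belongs to `𝓨(X)`: it is finitely generated and `Ext¹ (N, M) = 0` for all `N` in `𝓕(X)`. -/
def IsExtInjectiveFor {t : ℕ} (X : Fin t → ModuleCat.{u} R) (M : ModuleCat.{u} R) : Prop :=
  Module.Finite R M ∧
    ∀ N : ModuleCat.{u} R, IsFilteredBy X N → Subsingleton (Abelian.Ext N M 1)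

/-- `M` belongs to `add T`: it is a finite direct sum of direct summands of `T`. -/
def InAdd (T M : ModuleCat.{u} R) : Prop :=
  ∃ (s : ℕ) (N : Fin s → ModuleCat.{u} R),
    (∀ i, ∃ C : ModuleCat.{u} R, Nonempty (T ≅ N i ⊞ C)) ∧ Nonempty (M ≅ ⨁ N)

/-- A finitely generated module is partial tilting if it has projective dimension at most one
and no self-extensions. -/
structure IsPartialTilting (T : ModuleCat.{u} R) : Prop where
  finite : Module.Finite R T
  projectiveDimension_le_one : HasProjectiveDimensionLE T 1
  ext_eq_zero : Subsingleton (Abelian.Ext T T 1)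

/-- A module is basic if it is a finite direct sum of pairwise non-isomorphic indecomposable
modules. -/
def IsBasicModule (T : ModuleCat.{u} R) : Prop :=
  ∃ (s : ℕ) (N : Fin s → ModuleCat.{u} R), (∀ i, Indecomposable (N i)) ∧
    (∀ i j, i ≠ j → IsEmpty (N i ≅ N j)) ∧ Nonempty (T ≅ ⨁ N)

end Modules

/-! Membership in 𝓨(X) only has to be tested on the X_k, so T must collect the indecomposable M in
𝓕(X) with Ext¹(X_k, M) = 0 for all k.

Existence of T. Every M in 𝓕(X) embeds, with cokernel in 𝓕(X), into an object of 𝓕(X) ∩ 𝓨(X):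
universal extensions by X_{t-1}, …, X_0 are taken in this order, and Ext¹(X_k, X_l) = 0 for l ≤ k
keeps the vanishing already obtained (`IsStratified.exists_envelope`). If Y_i is such an envelope of
X_i, a horseshoe argument embeds any filtered M, with filtered cokernel, into a finite direct sum of
copies of the Y_i. When M is in 𝓨(X) this embedding splits, so by Krull–Schmidt only the finitely
many indecomposable summands of ⨁ Y_i occur; T is the sum of one from each isomorphism class
(`IsStratified.exists_indecomposables`). These summands lie in 𝓕(X) because it is closed under
direct summands (`IsStratified.filt_of_isRetractOf`). Finally Ext¹(T, T) = 0, since T is both in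
𝓕(X) and in 𝓨(X).

Projective dimension. Path algebras are hereditary. A derivation on KQ can be prescribed freely on
arrows, so derivations lift along surjections, and hence kernels of maps from projectives are
projective (`PathAlgebra.exists_section_of_isShortExact`).

Bound t ≤ n. If Ext¹(X, N) = 0, then dim Hom(X, N) is the Euler form of the dimension vectors
(`PathAlgebra.finrank_ker_homDifferential`). On a stratifying system this form is triangular with
nonzero diagonal, so the t dimension vectors are independent in ℚⁿ. -/

/-! ### Vanishing of Ext¹ as extendability of homomorphisms. -/

section ExtVanishing

variable (R : Type u) [Ring R]

/-- First extension group vanishes, phrased through extension of homomorphisms. -/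
def ExtVanishes (X M : Type u) [AddCommGroup X] [Module R X] [AddCommGroup M] [Module R M] : Prop :=
  ∀ (A B : Type u) [AddCommGroup A] [Module R A] [AddCommGroup B] [Module R B]
    (i : A →ₗ[R] B) (p : B →ₗ[R] X), Function.Injective i → Function.Exact i p →
    Function.Surjective p → ∀ f : A →ₗ[R] M, ∃ g : B →ₗ[R] M, g ∘ₗ i = f

variable {R}

/-- A short exact sequence of linear maps. -/
structure IsShortExact {A B C : Type*} [AddCommGroup A] [Module R A] [AddCommGroup B] [Module R B]
    [AddCommGroup C] [Module R C] (i : A →ₗ[R] B) (p : B →ₗ[R] C) : Prop where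
  injective : Function.Injective i
  exact : Function.Exact i p
  surjective : Function.Surjective p

section

variable {A B C : Type u} [AddCommGroup A] [Module R A] [AddCommGroup B] [Module R B]
  [AddCommGroup C] [Module R C] {i : A →ₗ[R] B} {p : B →ₗ[R] C}

theorem IsShortExact.comp_eq_zero (h : IsShortExact i p) (a : A) : p (i a) = 0 :=
  h.exact.apply_apply_eq_zero a

/-- The short complex in the category of modules attached to a short exact sequence. -/
abbrev IsShortExact.shortComplex (h : IsShortExact i p) : ShortComplex (ModuleCat.{u} R) :=
  ShortComplex.mk (ModuleCat.ofHom i) (ModuleCat.ofHom p) (by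
    ext a; exact h.comp_eq_zero a)

theorem IsShortExact.shortExact (h : IsShortExact i p) : h.shortComplex.ShortExact where
  exact := (ShortComplex.ShortExact.moduleCat_exact_iff_function_exact _).2 h.exact
  mono_f := (ModuleCat.mono_iff_injective _).2 h.injective
  epi_g := (ModuleCat.epi_iff_surjective _).2 h.surjective

end

variable {X M : Type u} [AddCommGroup X] [Module R X] [AddCommGroup M] [Module R M]

theorem ExtVanishes.extend (h : ExtVanishes R X M)
    {A B : Type u} [AddCommGroup A] [Module R A] [AddCommGroup B] [Module R B]
    {i : A →ₗ[R] B} {p : B →ₗ[R] X} (hs : IsShortExact i p) (f : A →ₗ[R] M) :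
    ∃ g : B →ₗ[R] M, g ∘ₗ i = f :=
  h A B i p hs.injective hs.exact hs.surjective f

theorem isShortExact_subtype_mkQ {A : Type*} [AddCommGroup A] [Module R A] (U : Submodule R A) :
    IsShortExact U.subtype U.mkQ where
  injective := U.injective_subtype
  exact := LinearMap.exact_subtype_mkQ U
  surjective := U.mkQ_surjective

theorem isShortExact_ker {A C : Type*} [AddCommGroup A] [Module R A] [AddCommGroup C] [Module R C]
    (p : A →ₗ[R] C) (hp : Function.Surjective p) : IsShortExact (LinearMap.ker p).subtype p where
  injective := Submodule.injective_subtype _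
  exact := LinearMap.exact_subtype_ker_map p
  surjective := hp

theorem extVanishes_of_subsingleton (h : Subsingleton (Abelian.Ext (ModuleCat.of R X)
    (ModuleCat.of R M) 1)) : ExtVanishes R X M := by
  intro A B _ _ _ _ i p hi hip hp f
  have hs := IsShortExact.shortExact ⟨hi, hip, hp⟩
  -- The obstruction to extending `f` along `i` lies in Ext¹(X, M).
  obtain ⟨x, hx⟩ := Abelian.Ext.contravariant_sequence_exact₁ hs (ModuleCat.of R M)
    (Abelian.Ext.mk₀ (ModuleCat.ofHom f)) (n₁ := 1) rfl (Subsingleton.elim _ _)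
  obtain ⟨g, rfl⟩ := (Abelian.Ext.mk₀_bijective _ _).2 x
  rw [Abelian.Ext.mk₀_comp_mk₀] at hx
  have := (Abelian.Ext.mk₀_bijective _ _).1 hx
  exact ⟨g.hom, congrArg ModuleCat.Hom.hom this⟩

/-- It suffices to test vanishing on one presentation with projective middle term. -/
theorem subsingleton_ext_of_projective {A P : Type u} [AddCommGroup A] [Module R A]
    [AddCommGroup P] [Module R P] [Module.Projective R P] {i : A →ₗ[R] P} {p : P →ₗ[R] X}
    (h : IsShortExact i p) (H : ∀ f : A →ₗ[R] M, ∃ g : P →ₗ[R] M, g ∘ₗ i = f) :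
    Subsingleton (Abelian.Ext (ModuleCat.of R X) (ModuleCat.of R M) 1) := by
  have hs := h.shortExact
  have hP : Projective (ModuleCat.of R P) :=
    (IsProjective.iff_projective _).1 inferInstance
  refine subsingleton_of_forall_eq 0 fun e => ?_
  -- As Ext¹(P, M) = 0, the class `e` is the image of some `f : A → M` under the connecting map;
  -- that image vanishes once `f` extends to `P`.
  obtain ⟨x, hx⟩ := Abelian.Ext.contravariant_sequence_exact₃ hs (ModuleCat.of R M) e
    (Subsingleton.elim (h := HasProjectiveDimensionLT.subsingleton (ModuleCat.of R P) 1 1 le_rfl _)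
      _ _) (n₀ := 0) rfl
  obtain ⟨f, rfl⟩ := (Abelian.Ext.mk₀_bijective _ _).2 x
  obtain ⟨g, hg⟩ := H f.hom
  have hf : f = h.shortComplex.f ≫ ModuleCat.ofHom g := by
    ext a; exact (LinearMap.congr_fun hg a).symm
  rw [← hx, hf, ← Abelian.Ext.mk₀_comp_mk₀, ← Abelian.Ext.comp_assoc _ _ _ (add_zero 1) rfl rfl,
    hs.extClass_comp, Abelian.Ext.zero_comp]

theorem exists_free_presentation (X : Type u) [AddCommGroup X] [Module R X] :
    ∃ (A P : Type u) (_ : AddCommGroup A) (_ : Module R A) (_ : AddCommGroup P) (_ : Module R P)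
      (i : A →ₗ[R] P) (p : P →ₗ[R] X), Module.Projective R P ∧ IsShortExact i p :=
  ⟨_, X →₀ R, _, _, _, _, _, Finsupp.linearCombination R id, inferInstance,
    isShortExact_ker _ (Finsupp.linearCombination_id_surjective R X)⟩

theorem extVanishes_iff :
    ExtVanishes R X M ↔ Subsingleton (Abelian.Ext (ModuleCat.of R X) (ModuleCat.of R M) 1) := by
  refine ⟨fun h => ?_, extVanishes_of_subsingleton⟩
  obtain ⟨A, P, _, _, _, _, i, p, _, hs⟩ := exists_free_presentation (R := R) X
  exact subsingleton_ext_of_projective hs fun f => h.extend hs f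

variable {X' X'' M' M'' : Type u} [AddCommGroup X'] [Module R X'] [AddCommGroup M'] [Module R M']
  [AddCommGroup X''] [Module R X''] [AddCommGroup M''] [Module R M'']

theorem ExtVanishes.of_retract_right (h : ExtVanishes R X M) (i : M' →ₗ[R] M) (r : M →ₗ[R] M')
    (hr : r ∘ₗ i = LinearMap.id) : ExtVanishes R X M' := by
  intro A B _ _ _ _ a b h1 h2 h3 f
  obtain ⟨g, hg⟩ := h A B a b h1 h2 h3 (i ∘ₗ f)
  exact ⟨r ∘ₗ g, by rw [LinearMap.comp_assoc, hg, ← LinearMap.comp_assoc, hr, LinearMap.id_comp]⟩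

theorem ExtVanishes.of_equiv_left (h : ExtVanishes R X M) (e : X ≃ₗ[R] X') :
    ExtVanishes R X' M := by
  intro A B _ _ _ _ a b h1 h2 h3 f
  refine h A B a (e.symm.toLinearMap ∘ₗ b) h1 ?_ (e.symm.surjective.comp h3) f
  intro x
  rw [← h2 x]
  simp

theorem extVanishes_pi {ι : Type} (M : ι → Type u) [∀ i, AddCommGroup (M i)]
    [∀ i, Module R (M i)] (h : ∀ i, ExtVanishes R X (M i)) : ExtVanishes R X (∀ i, M i) := by
  intro A B _ _ _ _ a b h1 h2 h3 f
  choose g hg using fun i => h i A B a b h1 h2 h3 (LinearMap.proj i ∘ₗ f)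
  refine ⟨LinearMap.pi g, ?_⟩
  ext x i
  exact LinearMap.congr_fun (hg i) x

theorem ExtVanishes.of_exact_right {i : M' →ₗ[R] M} {p : M →ₗ[R] M''} (hs : IsShortExact i p)
    (h' : ExtVanishes R X M') (h'' : ExtVanishes R X M'') : ExtVanishes R X M := by
  rw [extVanishes_iff] at h' h'' ⊢
  refine subsingleton_of_forall_eq 0 fun e => ?_
  obtain ⟨x, hx⟩ := Abelian.Ext.covariant_sequence_exact₂ (ModuleCat.of R X) hs.shortExact e
    (Subsingleton.elim (h := h'') _ _)
  rw [← hx, Subsingleton.elim (h := h') x 0, Abelian.Ext.zero_comp]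

theorem ExtVanishes.of_exact_left {i : X' →ₗ[R] X} {p : X →ₗ[R] X''} (hs : IsShortExact i p)
    (h' : ExtVanishes R X' M) (h'' : ExtVanishes R X'' M) : ExtVanishes R X M := by
  rw [extVanishes_iff] at h' h'' ⊢
  refine subsingleton_of_forall_eq 0 fun e => ?_
  obtain ⟨x, hx⟩ := Abelian.Ext.contravariant_sequence_exact₂ hs.shortExact (ModuleCat.of R M) e
    (Subsingleton.elim (h := h') _ _)
  rw [← hx, Subsingleton.elim (h := h'') x 0, Abelian.Ext.comp_zero]

theorem extVanishes_of_subsingleton_left [Subsingleton X] : ExtVanishes R X M := by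
  intro A B _ _ _ _ a b h1 h2 h3 f
  have hs : Function.Surjective a := fun y => (h2 y).1 (Subsingleton.elim _ _)
  let e := LinearEquiv.ofBijective a ⟨h1, hs⟩
  refine ⟨f ∘ₗ e.symm.toLinearMap, ?_⟩
  ext x
  exact congrArg f (e.symm_apply_apply x)

/-- A short exact sequence whose extension group vanishes splits. -/
theorem ExtVanishes.exists_retraction {B : Type u} [AddCommGroup B] [Module R B]
    (h : ExtVanishes R X M) {i : M →ₗ[R] B} {p : B →ₗ[R] X}
    (hs : IsShortExact i p) : ∃ r : B →ₗ[R] M, r ∘ₗ i = LinearMap.id :=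
  h.extend hs _

end ExtVanishing

/-! ### Finite direct sums, retracts and Krull–Schmidt. -/

section DirectSums

variable {R : Type u} [Ring R]

theorem isZero_iff_subsingleton (M : ModuleCat.{u} R) : IsZero M ↔ Subsingleton M :=
  ModuleCat.isZero_iff_subsingleton

theorem CategoryTheory.Indecomposable.nontrivial {M : ModuleCat.{u} R} (h : Indecomposable M) : Nontrivial M := by
  rw [← not_subsingleton_iff_nontrivial, ← isZero_iff_subsingleton]
  exact h.1

theorem CategoryTheory.Indecomposable.subsingleton_or {M : ModuleCat.{u} R} (h : Indecomposable M)
    {A B : Type u} [AddCommGroup A] [Module R A] [AddCommGroup B] [Module R B]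
    (e : M ≃ₗ[R] A × B) : Subsingleton A ∨ Subsingleton B := by
  have := h.2 (ModuleCat.of R A) (ModuleCat.of R B)
    (e.toModuleIso ≪≫ (ModuleCat.biprodIsoProd (ModuleCat.of R A) (ModuleCat.of R B)).symm)
  simpa only [isZero_iff_subsingleton] using this

theorem exists_nontrivial_equiv_prod {M : ModuleCat.{u} R} [Nontrivial M]
    (h : ¬ Indecomposable M) : ∃ A B : ModuleCat.{u} R, Nontrivial A ∧ Nontrivial B ∧
      Nonempty (M ≃ₗ[R] A × B) := by
  have h0 : ¬ IsZero M := by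
    rwa [isZero_iff_subsingleton, not_subsingleton_iff_nontrivial]
  have : ∃ A B : ModuleCat.{u} R, ∃ _ : M ≅ A ⊞ B, ¬ IsZero A ∧ ¬ IsZero B := by
    by_contra! H
    exact h ⟨h0, fun A B e => or_iff_not_imp_left.2 (H A B e)⟩
  obtain ⟨A, B, e, hA, hB⟩ := this
  rw [isZero_iff_subsingleton, not_subsingleton_iff_nontrivial] at hA hB
  exact ⟨A, B, hA, hB, ⟨(e ≪≫ ModuleCat.biprodIsoProd A B).toLinearEquiv⟩⟩

/-- `A` is a retract, that is, isomorphic to a direct summand, of `M`. -/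
def IsRetractOf (R : Type u) [Ring R] (A M : Type*) [AddCommGroup A] [Module R A] [AddCommGroup M]
    [Module R M] : Prop :=
  ∃ (i : A →ₗ[R] M) (r : M →ₗ[R] A), r ∘ₗ i = LinearMap.id

section

variable {A B M N : Type*} [AddCommGroup A] [Module R A] [AddCommGroup M] [Module R M]
  [AddCommGroup B] [Module R B] [AddCommGroup N] [Module R N]

theorem IsRetractOf.trans (h : IsRetractOf R A M) (h' : IsRetractOf R M N) :
    IsRetractOf R A N := by
  obtain ⟨i, r, hr⟩ := h
  obtain ⟨j, s, hs⟩ := h'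
  refine ⟨j ∘ₗ i, r ∘ₗ s, ?_⟩
  rw [LinearMap.comp_assoc, ← LinearMap.comp_assoc _ j s, hs, LinearMap.id_comp, hr]

theorem LinearEquiv.isRetractOf (e : A ≃ₗ[R] M) : IsRetractOf R A M :=
  ⟨e.toLinearMap, e.symm.toLinearMap, by ext; simp⟩

theorem isRetractOf_prod_left : IsRetractOf R A (A × B) :=
  ⟨LinearMap.inl R A B, LinearMap.fst R A B, by ext; simp⟩

theorem isRetractOf_prod_right : IsRetractOf R B (A × B) :=
  ⟨LinearMap.inr R A B, LinearMap.snd R A B, by ext; simp⟩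

theorem isRetractOf_pi {ι : Type*} [DecidableEq ι] (M : ι → Type*) [∀ i, AddCommGroup (M i)]
    [∀ i, Module R (M i)] (i : ι) : IsRetractOf R (M i) (∀ i, M i) :=
  ⟨LinearMap.single R M i, LinearMap.proj i, by ext; simp⟩

theorem IsRetractOf.finite (h : IsRetractOf R A M) [Module.Finite R M] : Module.Finite R A := by
  obtain ⟨i, r, hr⟩ := h
  exact Module.Finite.of_surjective r fun a => ⟨i a, LinearMap.congr_fun hr a⟩

/-- A retraction identifies the ambient module with the product of the retract and the kernel. -/
noncomputable def retractEquivProd (i : A →ₗ[R] M) (r : M →ₗ[R] A) (hr : r ∘ₗ i = LinearMap.id) :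
    M ≃ₗ[R] A × LinearMap.ker r :=
  have hri (a : A) : r (i a) = a := LinearMap.congr_fun hr a
  LinearEquiv.ofLinearMap
    (r.prod ((LinearMap.id - i ∘ₗ r).codRestrict (LinearMap.ker r) fun x => by simp [hri]))
    (i.coprod (LinearMap.ker r).subtype)
    (by
      ext x
      · simp [hri]
      · simp [hri]
      · simp
      · have : r x.1 = 0 := x.2
        simp [this])
    (by ext x; simp)

end

/-- Finite direct sums of modules of the class `C`. -/
inductive DirectSumOf (C : ModuleCat.{u} R → Prop) : ModuleCat.{u} R → Prop
  | zero (M : ModuleCat.{u} R) : Subsingleton M → DirectSumOf C M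
  | step (A X M : ModuleCat.{u} R) : ((A × X) ≃ₗ[R] M) → DirectSumOf C A → C X → DirectSumOf C M

namespace DirectSumOf

variable {C C' : ModuleCat.{u} R → Prop}

theorem of_equiv {M M' : ModuleCat.{u} R} (h : DirectSumOf C M) (e : M ≃ₗ[R] M') :
    DirectSumOf C M' := by
  cases h with
  | zero _ h => exact zero _ e.symm.toEquiv.subsingleton
  | step A X _ e' hA hX => exact step A X _ (e'.trans e) hA hX

theorem mono (hC : ∀ M, C M → C' M) {M : ModuleCat.{u} R} (h : DirectSumOf C M) :
    DirectSumOf C' M := by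
  induction h with
  | zero _ h => exact zero _ h
  | step A X _ e hA hX ih => exact step A X _ e ih (hC _ hX)

theorem prod {M N : ModuleCat.{u} R} (hM : DirectSumOf C M) (hN : DirectSumOf C N) :
    DirectSumOf C (ModuleCat.of R (M × N)) := by
  induction hN with
  | zero N h =>
    let _ : Unique N := uniqueOfSubsingleton 0
    exact hM.of_equiv (LinearEquiv.prodUnique : (M × N) ≃ₗ[R] M).symm
  | step A X N e hA hX ih =>
    exact step _ X _ ((LinearEquiv.prodAssoc R M A X).trans
      ((LinearEquiv.refl R M).prodCongr e)) ih hX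

theorem single {X : ModuleCat.{u} R} (h : C X) : DirectSumOf C X :=
  step (ModuleCat.of R PUnit) X X (LinearEquiv.uniqueProd) (zero _ inferInstance) h

theorem exists_equiv_pi {M : ModuleCat.{u} R} (h : DirectSumOf C M) :
    ∃ (s : ℕ) (N : Fin s → ModuleCat.{u} R), (∀ i, C (N i)) ∧ Nonempty (M ≃ₗ[R] ∀ i, N i) := by
  induction h with
  | zero M h =>
    exact ⟨0, Fin.elim0, fun i => i.elim0, ⟨LinearEquiv.ofSubsingleton _ _⟩⟩
  | step A X M e hA hX ih =>
    obtain ⟨s, N, hN, ⟨e'⟩⟩ := ih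
    refine ⟨s + 1, Fin.cons X N, Fin.cases hX hN, ⟨?_⟩⟩
    exact e.symm.trans ((LinearEquiv.prodComm R A X).trans
      (((LinearEquiv.refl R X).prodCongr e').trans
        (Fin.consLinearEquiv R fun i => (Fin.cons X N : Fin (s + 1) → ModuleCat.{u} R) i)))

end DirectSumOf

/-- Induction on the length. Each summand is recorded as a retract of `M`, so that it inherits
properties stable under retracts. -/
theorem directSumOf_indecomposable [IsNoetherianRing R] [IsArtinianRing R] (M : ModuleCat.{u} R)
    [Module.Finite R M] :
    DirectSumOf (fun N => Indecomposable N ∧ IsRetractOf R N M) M := by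
  have key : ∀ (n : ℕ∞) (M : ModuleCat.{u} R), Module.Finite R M → Module.length R M = n →
      DirectSumOf (fun N => Indecomposable N ∧ IsRetractOf R N M) M := by
    intro n
    induction n using WellFoundedLT.induction with
    | ind n ih =>
      intro M hM hn
      rcases subsingleton_or_nontrivial M with h | h
      · exact .zero _ h
      by_cases hi : Indecomposable M
      · exact .single ⟨hi, (LinearEquiv.refl R M).isRetractOf⟩
      obtain ⟨A, B, hA, hB, ⟨e⟩⟩ := exists_nontrivial_equiv_prod hi
      have rA : IsRetractOf R A M := isRetractOf_prod_left.trans e.symm.isRetractOf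
      have rB : IsRetractOf R B M := isRetractOf_prod_right.trans e.symm.isRetractOf
      have fA := rA.finite
      have fB := rB.finite
      have hl : Module.length R A + Module.length R B = n := by
        rw [← hn, e.length_eq, Module.length_prod]
      have tA : Module.length R A ≠ ⊤ := Module.length_ne_top
      have tB : Module.length R B ≠ ⊤ := Module.length_ne_top
      have pA : Module.length R A > 0 := Module.length_pos
      have pB : Module.length R B > 0 := Module.length_pos
      have lA : Module.length R A < n := by
        rw [← hl]; rw [add_comm]; exact ENat.lt_add_left tA pB
      have lB : Module.length R B < n := by
        rw [← hl]; exact ENat.lt_add_left tB pA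
      refine ((DirectSumOf.mono ?_ (ih _ lA A fA rfl)).prod
        (DirectSumOf.mono ?_ (ih _ lB B fB rfl))).of_equiv e.symm
      · exact fun N h => ⟨h.1, h.2.trans rA⟩
      · exact fun N h => ⟨h.1, h.2.trans rB⟩
  exact key _ M inferInstance rfl

section KrullSchmidt

/-- Fitting's lemma: for large k the module is the direct sum of the kernel and the range of `f ^
k`, so one of them is zero. -/
theorem CategoryTheory.Indecomposable.bijective_or_isNilpotent {N : ModuleCat.{u} R} (hN : Indecomposable N)
    [IsNoetherian R N] [IsArtinian R N] (f : Module.End R N) :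
    IsUnit f ∨ IsNilpotent f := by
  obtain ⟨k, hk⟩ := Filter.eventually_atTop.1 f.eventually_isCompl_ker_pow_range_pow
  -- The exponent is kept positive so that injectivity of the power `f ^ k * f` passes to `f`.
  have hc := hk (k + 1) (Nat.le_succ k)
  have := hN.subsingleton_or (Submodule.prodEquivOfIsCompl _ _ hc).symm
  rw [Submodule.subsingleton_iff_eq_bot, Submodule.subsingleton_iff_eq_bot] at this
  rcases this with h | h
  · left
    rw [Module.End.isUnit_iff]
    have hi : Function.Injective ((f ^ k) ∘ f) := by
      rw [← Module.End.coe_mul, ← pow_succ]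
      exact LinearMap.ker_eq_bot.1 h
    exact IsArtinian.bijective_of_injective_endomorphism f hi.of_comp
  · right
    exact ⟨k + 1, LinearMap.range_eq_bot.1 h⟩

theorem CategoryTheory.Indecomposable.isUnit_or_isUnit {N : ModuleCat.{u} R} (hN : Indecomposable N)
    [IsNoetherian R N] [IsArtinian R N] {f g : Module.End R N} (h : f + g = 1) :
    IsUnit f ∨ IsUnit g := by
  rcases hN.bijective_or_isNilpotent f with hf | hf
  · exact .inl hf
  · right
    rw [← eq_sub_iff_add_eq'] at h
    exact h ▸ hf.isUnit_one_sub

theorem IsRetractOf.of_isUnit {N A : Type*} [AddCommGroup A] [Module R A] [AddCommGroup N]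
    [Module R N] (i : N →ₗ[R] A) (r : A →ₗ[R] N) (h : IsUnit (r ∘ₗ i : Module.End R N)) :
    IsRetractOf R N A := by
  obtain ⟨u, hu⟩ := h
  refine ⟨i, (↑u⁻¹ : Module.End R N) ∘ₗ r, ?_⟩
  rw [LinearMap.comp_assoc, ← hu]
  exact u.inv_mul

/-- The identity of `N` is a sum of an endomorphism through `A` and one through `B`; the
endomorphism ring is local, so one of them is a unit. -/
theorem CategoryTheory.Indecomposable.isRetractOf_or {N : ModuleCat.{u} R} (hN : Indecomposable N)
    [IsNoetherian R N] [IsArtinian R N] {A B : Type u} [AddCommGroup A] [Module R A]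
    [AddCommGroup B] [Module R B] (h : IsRetractOf R N (A × B)) :
    IsRetractOf R N A ∨ IsRetractOf R N B := by
  obtain ⟨i, r, hr⟩ := h
  have : ((r ∘ₗ LinearMap.inl R A B) ∘ₗ (LinearMap.fst R A B ∘ₗ i) : Module.End R N) +
      (r ∘ₗ LinearMap.inr R A B) ∘ₗ (LinearMap.snd R A B ∘ₗ i) = 1 := by
    ext x
    have := LinearMap.congr_fun hr x
    simp only [LinearMap.add_apply, LinearMap.comp_apply, ← map_add] at this ⊢
    simpa using this
  rcases hN.isUnit_or_isUnit this with h | h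
  · exact .inl (.of_isUnit _ _ h)
  · exact .inr (.of_isUnit _ _ h)

theorem CategoryTheory.Indecomposable.equiv_of_isRetractOf {N X : ModuleCat.{u} R} (hN : Indecomposable N)
    (hX : Indecomposable X) (h : IsRetractOf R N X) : Nonempty (N ≃ₗ[R] X) := by
  obtain ⟨i, r, hr⟩ := h
  have e := retractEquivProd i r hr
  have := hN.nontrivial
  have hs := (hX.subsingleton_or e).resolve_left (not_subsingleton _)
  let _ : Unique (LinearMap.ker r) := Unique.mk' _
  exact ⟨(e.trans LinearEquiv.prodUnique).symm⟩

theorem DirectSumOf.equiv_of_isRetractOf {C : ModuleCat.{u} R → Prop}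
    (hC : ∀ X, C X → Indecomposable X) {M N : ModuleCat.{u} R} (hM : DirectSumOf C M)
    (hN : Indecomposable N) [IsNoetherian R N] [IsArtinian R N] (h : IsRetractOf R N M) :
    ∃ X, C X ∧ Nonempty (N ≃ₗ[R] X) := by
  induction hM with
  | zero M hM =>
    obtain ⟨i, r, hr⟩ := h
    have hs : Subsingleton N :=
      (Function.LeftInverse.injective (LinearMap.congr_fun hr) :
        Function.Injective i).subsingleton
    exact absurd ((isZero_iff_subsingleton _).2 hs) hN.1
  | step A X M e hA hX ih =>
    rcases hN.isRetractOf_or (h.trans e.symm.isRetractOf) with h | h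
    · exact ih h
    · exact ⟨X, hX, hN.equiv_of_isRetractOf (hC X hX) h⟩

/-- Each indecomposable summand of `N` is a retract of `M`, hence isomorphic to one of the summands
of `M`. -/
theorem DirectSumOf.of_isRetractOf [IsNoetherianRing R] [IsArtinianRing R]
    {C : ModuleCat.{u} R → Prop} (hC : ∀ X, C X → Indecomposable X)
    (hC' : ∀ X Y : ModuleCat.{u} R, C X → Nonempty (Y ≃ₗ[R] X) → C Y) {M N : ModuleCat.{u} R}
    (hM : DirectSumOf C M) [Module.Finite R N] (h : IsRetractOf R N M) : DirectSumOf C N := by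
  refine (directSumOf_indecomposable N).mono fun Y hY => ?_
  have : Module.Finite R Y := hY.2.finite
  obtain ⟨X, hX, e⟩ := hM.equiv_of_isRetractOf hC hY.1 (hY.2.trans h)
  exact hC' X Y hX e

end KrullSchmidt

end DirectSums

/-! ### Short exact sequences and modules filtered by a class. -/

section Filtrations

variable {R : Type u} [Ring R]

section Exactness

variable {A B C D E F : Type*} [AddCommGroup A] [Module R A] [AddCommGroup B] [Module R B]
  [AddCommGroup C] [Module R C] [AddCommGroup D] [Module R D] [AddCommGroup E] [Module R E]
  [AddCommGroup F] [Module R F]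

theorem LinearMap.exists_comp_eq_of_surjective (p : A →ₗ[R] B) (hp : Function.Surjective p)
    (f : A →ₗ[R] C) (h : LinearMap.ker p ≤ LinearMap.ker f) : ∃ g : B →ₗ[R] C, g ∘ₗ p = f := by
  refine ⟨(LinearMap.ker p).liftQ f h ∘ₗ (p.quotKerEquivOfSurjective hp).symm.toLinearMap, ?_⟩
  ext x
  have : (p.quotKerEquivOfSurjective hp).symm (p x) = (LinearMap.ker p).mkQ x := by
    rw [LinearEquiv.symm_apply_eq]; rfl
  simp [this]

theorem LinearMap.exists_comp_eq_of_injective (i : A →ₗ[R] B) (hi : Function.Injective i)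
    (f : C →ₗ[R] B) (h : LinearMap.range f ≤ LinearMap.range i) :
    ∃ g : C →ₗ[R] A, i ∘ₗ g = f := by
  refine ⟨(LinearEquiv.ofInjective i hi).symm.toLinearMap ∘ₗ
    f.codRestrict (LinearMap.range i) fun c => h ⟨c, rfl⟩, ?_⟩
  ext x
  have := congrArg Subtype.val ((LinearEquiv.ofInjective i hi).apply_symm_apply
    (f.codRestrict (LinearMap.range i) (fun c => h ⟨c, rfl⟩) x))
  exact this

theorem IsShortExact.exists_lift {i : A →ₗ[R] B} {p : B →ₗ[R] C} (h : IsShortExact i p)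
    (f : D →ₗ[R] B) (hf : p ∘ₗ f = 0) : ∃ g : D →ₗ[R] A, i ∘ₗ g = f := by
  refine LinearMap.exists_comp_eq_of_injective i h.injective f ?_
  rintro _ ⟨x, rfl⟩
  exact (h.exact (f x)).1 (LinearMap.congr_fun hf x)

theorem IsShortExact.exists_desc {i : A →ₗ[R] B} {p : B →ₗ[R] C} (h : IsShortExact i p)
    (f : B →ₗ[R] D) (hf : f ∘ₗ i = 0) : ∃ g : C →ₗ[R] D, g ∘ₗ p = f := by
  refine LinearMap.exists_comp_eq_of_surjective p h.surjective f ?_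
  intro x hx
  obtain ⟨a, rfl⟩ := (h.exact x).1 hx
  exact LinearMap.congr_fun hf a

theorem IsShortExact.equiv_middle {i : A →ₗ[R] B} {p : B →ₗ[R] C} (h : IsShortExact i p)
    (e : B ≃ₗ[R] D) : IsShortExact (e.toLinearMap ∘ₗ i) (p ∘ₗ e.symm.toLinearMap) where
  injective := e.injective.comp h.injective
  exact x := by
    have := h.exact (e.symm x)
    simp only [LinearMap.comp_apply, LinearEquiv.coe_coe, this, Set.mem_range,
      LinearEquiv.eq_symm_apply]
  surjective := h.surjective.comp e.symm.surjective

theorem IsShortExact.equiv_left {i : A →ₗ[R] B} {p : B →ₗ[R] C} (h : IsShortExact i p)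
    (e : D ≃ₗ[R] A) : IsShortExact (i ∘ₗ e.toLinearMap) p where
  injective := h.injective.comp e.injective
  exact x := by
    rw [h.exact x]
    exact ⟨fun ⟨a, ha⟩ => ⟨e.symm a, by simpa using ha⟩, fun ⟨a, ha⟩ => ⟨e a, ha⟩⟩
  surjective := h.surjective

theorem IsShortExact.equiv_right {i : A →ₗ[R] B} {p : B →ₗ[R] C} (h : IsShortExact i p)
    (e : C ≃ₗ[R] D) : IsShortExact i (e.toLinearMap ∘ₗ p) where
  injective := h.injective
  exact x := by rw [← h.exact x]; simp
  surjective := e.surjective.comp h.surjective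

theorem isShortExact_snd : IsShortExact (LinearMap.inl R A B) (LinearMap.snd R A B) where
  injective := LinearMap.inl_injective
  exact x := ⟨fun h => ⟨x.1, Prod.ext rfl h.symm⟩, by rintro ⟨y, rfl⟩; rfl⟩
  surjective := LinearMap.snd_surjective

/-- Preimage of a submodule of the quotient term of a short exact sequence. -/
theorem IsShortExact.comap {i : A →ₗ[R] B} {p : B →ₗ[R] C} (h : IsShortExact i p)
    (U : Submodule R C) : ∃ (j : A →ₗ[R] U.comap p) (q : U.comap p →ₗ[R] U),
      IsShortExact j q :=
  ⟨i.codRestrict _ fun a => by simp [h.exact.apply_apply_eq_zero a], p.restrict fun _ hx => hx, {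
    injective := fun a b hab => h.injective (congrArg Subtype.val hab)
    exact := fun x => by
      constructor
      · intro hx
        obtain ⟨a, ha⟩ := (h.exact x.1).1 (congrArg Subtype.val hx)
        exact ⟨a, Subtype.ext ha⟩
      · rintro ⟨a, rfl⟩
        exact Subtype.ext (h.exact.apply_apply_eq_zero a)
    surjective := fun y => by
      obtain ⟨x, hx⟩ := h.surjective y.1
      exact ⟨⟨x, by simp [hx]⟩, Subtype.ext hx⟩ }⟩

/-- Third isomorphism theorem in terms of short exact sequences. -/
theorem IsShortExact.exists_comp {i : A →ₗ[R] B} {p : B →ₗ[R] C} (h : IsShortExact i p)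
    {j : B →ₗ[R] D} {q : D →ₗ[R] E} (h' : IsShortExact j q) :
    ∃ (π : D →ₗ[R] D ⧸ LinearMap.range (j ∘ₗ i)) (a : C →ₗ[R] D ⧸ LinearMap.range (j ∘ₗ i))
      (b : (D ⧸ LinearMap.range (j ∘ₗ i)) →ₗ[R] E),
      IsShortExact (j ∘ₗ i) π ∧ IsShortExact a b ∧ a ∘ₗ p = π ∘ₗ j := by
  set U := LinearMap.range (j ∘ₗ i) with hU
  have hπ : IsShortExact (j ∘ₗ i) U.mkQ :=
    { injective := h'.injective.comp h.injective
      exact := LinearMap.exact_iff.2 (by rw [Submodule.ker_mkQ])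
      surjective := U.mkQ_surjective }
  obtain ⟨a, ha⟩ := h.exists_desc (U.mkQ ∘ₗ j) (by
    ext x; exact (Submodule.Quotient.mk_eq_zero _).2 ⟨x, rfl⟩)
  obtain ⟨b, hb⟩ := hπ.exists_desc q (by
    ext x; exact h'.exact.apply_apply_eq_zero _)
  have ha' (x : B) : a (p x) = U.mkQ (j x) := LinearMap.congr_fun ha x
  have hb' (x : D) : b (U.mkQ x) = q x := LinearMap.congr_fun hb x
  refine ⟨U.mkQ, a, b, hπ, ⟨?_, ?_, ?_⟩, ha⟩
  · rw [injective_iff_map_eq_zero]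
    intro c hc
    obtain ⟨x, rfl⟩ := h.surjective c
    rw [ha'] at hc
    obtain ⟨y, hy⟩ := (Submodule.Quotient.mk_eq_zero _).1 hc
    rw [← h'.injective hy]
    exact h.exact.apply_apply_eq_zero _
  · intro z
    obtain ⟨x, rfl⟩ := U.mkQ_surjective z
    rw [hb', h'.exact x]
    constructor
    · rintro ⟨y, rfl⟩
      exact ⟨p y, ha' y⟩
    · rintro ⟨c, hc⟩
      obtain ⟨y, rfl⟩ := h.surjective c
      rw [ha', ← sub_eq_zero, ← map_sub] at hc
      obtain ⟨w, hw⟩ := (Submodule.Quotient.mk_eq_zero _).1 hc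
      refine ⟨y - i w, ?_⟩
      rw [map_sub, sub_eq_iff_eq_add, ← sub_eq_iff_eq_add']
      exact hw.symm
  · intro e
    obtain ⟨x, rfl⟩ := h'.surjective e
    exact ⟨_, hb' x⟩

/-- A retraction of the left map identifies the middle term with the product. -/
theorem IsShortExact.exists_equiv_prod {i : A →ₗ[R] B} {p : B →ₗ[R] C} (h : IsShortExact i p)
    (r : B →ₗ[R] A) (hr : r ∘ₗ i = LinearMap.id) : ∃ e : B ≃ₗ[R] A × C, ∀ x, e x = (r x, p x) := by
  have hri (a : A) : r (i a) = a := LinearMap.congr_fun hr a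
  refine ⟨LinearEquiv.ofBijective (r.prod p) ⟨?_, ?_⟩, fun x => rfl⟩
  · rw [injective_iff_map_eq_zero]
    intro x hx
    obtain ⟨a, rfl⟩ := (h.exact x).1 (congrArg Prod.snd hx)
    have : r (i a) = 0 := congrArg Prod.fst hx
    rw [← hri a, this, map_zero]
  · rintro ⟨a, c⟩
    obtain ⟨x, rfl⟩ := h.surjective c
    refine ⟨x + i (a - r x), Prod.ext ?_ ?_⟩
    · simp [hri]
    · simp [h.exact.apply_apply_eq_zero]

end Exactness

/-- Iterated extensions of modules of the class `C`. -/
inductive Filt (C : ModuleCat.{u} R → Prop) : ModuleCat.{u} R → Prop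
  | zero (M : ModuleCat.{u} R) : Subsingleton M → Filt C M
  | step (A M X : ModuleCat.{u} R) (i : A →ₗ[R] M) (p : M →ₗ[R] X) :
      IsShortExact i p → Filt C A → C X → Filt C M

namespace Filt

variable {C C' : ModuleCat.{u} R → Prop}

theorem of_equiv {M M' : ModuleCat.{u} R} (h : Filt C M) (e : M ≃ₗ[R] M') : Filt C M' := by
  cases h with
  | zero _ h => exact zero _ e.symm.toEquiv.subsingleton
  | step A _ X i p hs hA hX => exact step A _ X _ _ (hs.equiv_middle e) hA hX

theorem mono (hC : ∀ M, C M → C' M) {M : ModuleCat.{u} R} (h : Filt C M) : Filt C' M := by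
  induction h with
  | zero _ h => exact zero _ h
  | step A M X i p hs hA hX ih => exact step A M X i p hs ih (hC _ hX)

/-- Induction on the filtration of the quotient: the preimage in `M` of its penultimate term `B'` is
an extension of `B'` by `A`, and the quotient of `M` by this preimage is the last factor `X`. -/
theorem extension {A M B : ModuleCat.{u} R} {i : A →ₗ[R] M} {p : M →ₗ[R] B}
    (hs : IsShortExact i p) (hA : Filt C A) (hB : Filt C B) : Filt C M := by
  induction hB generalizing M with
  | zero B h =>
    refine hA.of_equiv (LinearEquiv.ofBijective i ⟨hs.injective, fun x => ?_⟩)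
    exact (hs.exact x).1 (Subsingleton.elim _ _)
  | step B' B X j q hs' hB' hX ih =>
    obtain ⟨a, b, hab⟩ := hs.comap (LinearMap.ker q)
    obtain ⟨e, -⟩ : ∃ e : B' ≃ₗ[R] LinearMap.ker q, True :=
      ⟨(LinearEquiv.ofInjective j hs'.injective).trans
        (LinearEquiv.ofEq _ _ (LinearMap.exact_iff.1 hs'.exact).symm), trivial⟩
    have hU : Filt C (ModuleCat.of R ((LinearMap.ker q).comap p)) :=
      ih (hab.equiv_right e.symm)
    refine step _ M X ((LinearMap.ker q).comap p).subtype (q ∘ₗ p) ⟨?_, ?_, ?_⟩ hU hX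
    · exact Submodule.injective_subtype _
    · intro x; simp
    · exact hs'.surjective.comp hs.surjective

theorem single {X : ModuleCat.{u} R} (h : C X) : Filt C X :=
  step (ModuleCat.of R PUnit) X X 0 LinearMap.id
    ⟨Function.injective_of_subsingleton _, fun x => ⟨fun h => ⟨0, h.symm⟩, by
      rintro ⟨y, rfl⟩; rfl⟩, Function.surjective_id⟩ (zero _ inferInstance) h

theorem prod {M N : ModuleCat.{u} R} (hM : Filt C M) (hN : Filt C N) :
    Filt C (ModuleCat.of R (M × N)) :=
  extension (A := M) (B := N) (M := ModuleCat.of R (M × N)) isShortExact_snd hM hN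

theorem of_directSumOf {M : ModuleCat.{u} R} (h : DirectSumOf C M) : Filt C M := by
  induction h with
  | zero M h => exact zero M h
  | step A X M e hA hX ih => exact (ih.prod (single hX)).of_equiv e

theorem finite (hC : ∀ X, C X → Module.Finite R X) {M : ModuleCat.{u} R} (h : Filt C M) :
    Module.Finite R M := by
  induction h with
  | zero M h => infer_instance
  | step A M X i p hs hA hX ih =>
    have := hC X hX
    exact Module.Finite.of_exact hs.exact hs.surjective

theorem extVanishes_right {Y : Type u} [AddCommGroup Y] [Module R Y]
    (hC : ∀ X, C X → ExtVanishes R Y X) {M : ModuleCat.{u} R} (h : Filt C M) :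
    ExtVanishes R Y M := by
  induction h with
  | zero M h =>
    intro A B _ _ _ _ i p _ _ _ f
    exact ⟨0, LinearMap.ext fun x => Subsingleton.elim _ _⟩
  | step A M X i p hs hA hX ih => exact .of_exact_right hs ih (hC X hX)

theorem extVanishes_left {Y : Type u} [AddCommGroup Y] [Module R Y]
    (hC : ∀ X, C X → ExtVanishes R X Y) {M : ModuleCat.{u} R} (h : Filt C M) :
    ExtVanishes R M Y := by
  induction h with
  | zero M h => exact extVanishes_of_subsingleton_left
  | step A M X i p hs hA hX ih => exact .of_exact_left hs ih (hC X hX)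

theorem hom_eq_zero {Y : Type u} [AddCommGroup Y] [Module R Y]
    (hC : ∀ X, C X → ∀ f : Y →ₗ[R] X, f = 0) {M : ModuleCat.{u} R} (h : Filt C M)
    (f : Y →ₗ[R] M) : f = 0 := by
  induction h with
  | zero M h => exact LinearMap.ext fun x => Subsingleton.elim _ _
  | step A M X i p hs hA hX ih =>
    obtain ⟨g, rfl⟩ := hs.exists_lift f (hC X hX _)
    rw [ih g, LinearMap.comp_zero]

end Filt

theorem DirectSumOf.hom_eq_zero {C : ModuleCat.{u} R → Prop} {Y : Type u} [AddCommGroup Y]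
    [Module R Y] (hC : ∀ X, C X → ∀ f : X →ₗ[R] Y, f = 0) {M : ModuleCat.{u} R}
    (h : DirectSumOf C M) (f : M →ₗ[R] Y) : f = 0 := by
  induction h with
  | zero M h => exact LinearMap.ext fun x => by rw [Subsingleton.elim x 0, map_zero, map_zero]
  | step A X M e hA hX ih =>
    have h1 := ih (f ∘ₗ e.toLinearMap ∘ₗ LinearMap.inl R A X)
    have h2 := hC X hX (f ∘ₗ e.toLinearMap ∘ₗ LinearMap.inr R A X)
    have h3 : f ∘ₗ e.toLinearMap = 0 := LinearMap.prod_ext h1 h2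
    ext x
    simpa using LinearMap.congr_fun h3 (e.symm x)

section FilteredBy

variable {t : ℕ} (X : Fin t → ModuleCat.{u} R)

/-- The modules isomorphic to one of the first `k` members of the family `X`. -/
def FirstMembers (k : ℕ) (M : ModuleCat.{u} R) : Prop :=
  ∃ i : Fin t, i.val < k ∧ Nonempty (M ≃ₗ[R] X i)

variable {X}

theorem filt_of_isFilteredBy {M : ModuleCat.{u} R} (h : IsFilteredBy X M) :
    Filt (FirstMembers X t) M := by
  obtain ⟨s, F, hF, h0, hl, hq⟩ := h
  have key : ∀ i : Fin (s + 1), Filt (FirstMembers X t) (ModuleCat.of R (F i)) := by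
    intro i
    induction i using Fin.induction with
    | zero => exact .zero _ (by rw [h0]; infer_instance)
    | succ i ih =>
      obtain ⟨k, ⟨e⟩⟩ := hq i
      have hle : F i.castSucc ≤ F i.succ := hF (Fin.castSucc_lt_succ).le
      refine .step (ModuleCat.of R ((F i.castSucc).submoduleOf (F i.succ)))
        (ModuleCat.of R (F i.succ))
        (ModuleCat.of R (F i.succ ⧸ (F i.castSucc).submoduleOf (F i.succ))) _ _
        (isShortExact_subtype_mkQ _) ?_ ⟨k, k.2, ⟨e⟩⟩
      exact ih.of_equiv (Submodule.submoduleOfEquivOfLe hle).symm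
  refine (key (Fin.last s)).of_equiv ?_
  exact (LinearEquiv.ofEq _ _ hl).trans Submodule.topEquiv

/-- The quotient of the whole module by a submodule, seen inside the top submodule. -/
noncomputable def quotientSubmoduleOfTop {M : Type*} [AddCommGroup M] [Module R M]
    (U : Submodule R M) :
    ((⊤ : Submodule R M) ⧸ U.submoduleOf ⊤) ≃ₗ[R] M ⧸ U :=
  Submodule.Quotient.equiv _ _ Submodule.topEquiv (by
    ext x
    simp [Submodule.submoduleOf])

/-- An injective map identifies a subquotient with its image. -/
noncomputable def quotientSubmoduleOfMap {A M : Type*} [AddCommGroup A] [Module R A]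
    [AddCommGroup M] [Module R M] (i : A →ₗ[R] M) (hi : Function.Injective i)
    (U V : Submodule R A) :
    (V ⧸ U.submoduleOf V) ≃ₗ[R] V.map i ⧸ (U.map i).submoduleOf (V.map i) :=
  Submodule.Quotient.equiv _ _ (Submodule.equivMapOfInjective i hi V) (by
    ext ⟨y, hy⟩
    obtain ⟨x, hx, rfl⟩ := hy
    constructor
    · rintro ⟨z, hz, hzx⟩
      exact ⟨z.1, hz, congrArg Subtype.val hzx⟩
    · rintro ⟨z, hz, hzx⟩
      obtain rfl := hi hzx
      exact ⟨⟨z, hx⟩, hz, rfl⟩)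

theorem isFilteredBy_of_filt {M : ModuleCat.{u} R} (h : Filt (FirstMembers X t) M) :
    IsFilteredBy X M := by
  induction h with
  | zero M h => exact ⟨0, fun _ => ⊥, monotone_const, rfl, Subsingleton.elim _ _, fun i => i.elim0⟩
  | step A M Y i p hs hA hY ih =>
    obtain ⟨s, F, hF, h0, hl, hq⟩ := ih
    obtain ⟨k, -, ⟨e⟩⟩ := hY
    -- The chain of `A` is carried into `M` and `M` itself is appended; the new quotient is M / i(A)
    -- ≅ Y.
    refine ⟨s + 1, Fin.snoc (fun j => (F j).map i) ⊤, ?_, ?_, Fin.snoc_last _ _, ?_⟩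
    · rw [Fin.monotone_iff_le_succ]
      intro j
      induction j using Fin.lastCases with
      | last => rw [Fin.succ_last, Fin.snoc_last]; exact le_top
      | cast j =>
        rw [← Fin.castSucc_succ, Fin.snoc_castSucc, Fin.snoc_castSucc]
        exact Submodule.map_mono (hF Fin.castSucc_lt_succ.le)
    · rw [← Fin.castSucc_zero, Fin.snoc_castSucc, h0, Submodule.map_bot]
    · intro j
      induction j using Fin.lastCases with
      | last =>
        refine ⟨k, ?_⟩
        rw [Fin.succ_last, Fin.snoc_last, Fin.snoc_castSucc, hl, Submodule.map_top]
        rw [← LinearMap.exact_iff.1 hs.exact]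
        exact ⟨(quotientSubmoduleOfTop _).trans ((p.quotKerEquivOfSurjective hs.surjective).trans e)⟩
      | cast j =>
        obtain ⟨l, ⟨e⟩⟩ := hq j
        refine ⟨l, ?_⟩
        rw [← Fin.castSucc_succ, Fin.snoc_castSucc, Fin.snoc_castSucc]
        exact ⟨(quotientSubmoduleOfMap i hs.injective _ _).symm.trans e⟩

end FilteredBy

end Filtrations

/-! ### Pushouts, the horseshoe, and closure of 𝓕(X) under direct summands. -/

section StratifyingSystems

variable {R : Type u} [Ring R]

section Exactness

variable {A B C D E F : Type*} [AddCommGroup A] [Module R A] [AddCommGroup B] [Module R B]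
  [AddCommGroup C] [Module R C] [AddCommGroup D] [Module R D] [AddCommGroup E] [Module R E]
  [AddCommGroup F] [Module R F]

theorem IsShortExact.prodMap_id {i : A →ₗ[R] B} {p : B →ₗ[R] C} (h : IsShortExact i p) :
    IsShortExact (i.prodMap (LinearMap.id : D →ₗ[R] D)) (p ∘ₗ LinearMap.fst R B D) where
  injective := h.injective.prodMap Function.injective_id
  exact x := by
    constructor
    · intro hx
      obtain ⟨a, ha⟩ := (h.exact x.1).1 hx
      exact ⟨(a, x.2), Prod.ext ha rfl⟩
    · rintro ⟨y, rfl⟩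
      exact h.exact.apply_apply_eq_zero _
  surjective := h.surjective.comp LinearMap.fst_surjective

theorem isShortExact_zero_id (M : Type*) [AddCommGroup M] [Module R M] [Subsingleton A] :
    IsShortExact (0 : A →ₗ[R] M) LinearMap.id where
  injective := Function.injective_of_subsingleton _
  exact _ := ⟨fun h => ⟨0, h.symm⟩, by rintro ⟨y, rfl⟩; rfl⟩
  surjective := Function.surjective_id

theorem isShortExact_id_zero (M : Type*) [AddCommGroup M] [Module R M] [Subsingleton A] :
    IsShortExact LinearMap.id (0 : M →ₗ[R] A) where
  injective := Function.injective_id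
  exact _ := ⟨fun _ => ⟨_, rfl⟩, fun _ => rfl⟩
  surjective _ := ⟨0, Subsingleton.elim _ _⟩

theorem IsShortExact.pi {ι : Type*} {i : A →ₗ[R] B} {p : B →ₗ[R] C} (h : IsShortExact i p) :
    IsShortExact (i.compLeft ι) (p.compLeft ι) where
  injective x y hxy := funext fun k => h.injective (congrFun hxy k)
  exact x := by
    constructor
    · intro hx
      choose y hy using fun k => (h.exact (x k)).1 (congrFun hx k)
      exact ⟨y, funext hy⟩
    · rintro ⟨y, rfl⟩
      exact funext fun k => h.exact.apply_apply_eq_zero _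
  surjective x := by
    choose y hy using fun k => h.surjective (x k)
    exact ⟨y, funext hy⟩

theorem isShortExact_range_mkQ (i : A →ₗ[R] B) (hi : Function.Injective i) :
    IsShortExact i (LinearMap.range i).mkQ where
  injective := hi
  exact := LinearMap.exact_iff.2 (by rw [Submodule.ker_mkQ])
  surjective := Submodule.mkQ_surjective _

/-- Pushout of a short exact sequence along a homomorphism from the left term. -/
theorem IsShortExact.exists_pushout {i : A →ₗ[R] B} {p : B →ₗ[R] C} (h : IsShortExact i p)
    (φ : A →ₗ[R] D) :
    ∃ (j : D →ₗ[R] (D × B) ⧸ LinearMap.range (φ.prod (-i)))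
      (q : ((D × B) ⧸ LinearMap.range (φ.prod (-i))) →ₗ[R] C)
      (ψ : B →ₗ[R] (D × B) ⧸ LinearMap.range (φ.prod (-i))),
      IsShortExact j q ∧ ψ ∘ₗ i = j ∘ₗ φ := by
  -- The sign makes the pushout square commute.
  set κ := φ.prod (-i) with hκ
  have hs : IsShortExact κ (LinearMap.range κ).mkQ := isShortExact_range_mkQ κ (by
    intro x y hxy
    exact h.injective (neg_injective (congrArg Prod.snd hxy)))
  obtain ⟨q, hq⟩ := hs.exists_desc (p ∘ₗ LinearMap.snd R D B) (by
    ext x; simp [hκ, h.exact.apply_apply_eq_zero])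
  have hq' (x : D × B) : q ((LinearMap.range κ).mkQ x) = p x.2 := LinearMap.congr_fun hq x
  refine ⟨(LinearMap.range κ).mkQ ∘ₗ LinearMap.inl R D B, q,
    (LinearMap.range κ).mkQ ∘ₗ LinearMap.inr R D B, ⟨?_, ?_, ?_⟩, ?_⟩
  · rw [injective_iff_map_eq_zero]
    intro d hd
    obtain ⟨a, ha⟩ := (hs.exact _).1 hd
    have ha2 : -i a = 0 := congrArg Prod.snd ha
    have : a = 0 := h.injective (by rw [map_zero, ← neg_eq_zero, ha2])
    have ha1 : φ a = d := congrArg Prod.fst ha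
    rw [← ha1, this, map_zero]
  · intro z
    obtain ⟨⟨d, b⟩, rfl⟩ := hs.surjective z
    rw [hq']
    constructor
    · intro hb
      obtain ⟨a, rfl⟩ := (h.exact b).1 hb
      refine ⟨d + φ a, ?_⟩
      rw [LinearMap.comp_apply, ← sub_eq_zero, ← map_sub]
      exact (hs.exact _).2 ⟨a, by simp [hκ]⟩
    · rintro ⟨d', hd'⟩
      have := congrArg q hd'
      rw [LinearMap.comp_apply, hq', hq'] at this
      simpa using this.symm
  · intro c
    obtain ⟨b, rfl⟩ := h.surjective c
    exact ⟨_, hq' (0, b)⟩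
  · ext a
    refine (sub_eq_zero.1 ?_).symm
    rw [LinearMap.comp_apply, LinearMap.comp_apply, LinearMap.comp_apply, LinearMap.comp_apply,
      ← map_sub]
    exact (hs.exact _).2 ⟨a, by simp [hκ]⟩

/-- Two embeddings with a compatible extension combine to an embedding of the middle term. -/
theorem IsShortExact.exists_horseshoe {Y Z₁ Z₂ : Type*} [AddCommGroup Y] [Module R Y]
    [AddCommGroup Z₁] [Module R Z₁] [AddCommGroup Z₂] [Module R Z₂]
    {i : A →ₗ[R] B} {p : B →ₗ[R] Y} (h : IsShortExact i p)
    {j : A →ₗ[R] E} {q : E →ₗ[R] Z₁} (h₁ : IsShortExact j q)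
    {a : Y →ₗ[R] F} {b : F →ₗ[R] Z₂} (h₂ : IsShortExact a b)
    (g : B →ₗ[R] E) (hg : g ∘ₗ i = j) :
    ∃ (π : E × F →ₗ[R] (E × F) ⧸ LinearMap.range (g.prod (a ∘ₗ p)))
      (α : Z₁ →ₗ[R] (E × F) ⧸ LinearMap.range (g.prod (a ∘ₗ p)))
      (β : ((E × F) ⧸ LinearMap.range (g.prod (a ∘ₗ p))) →ₗ[R] Z₂),
      IsShortExact (g.prod (a ∘ₗ p)) π ∧ IsShortExact α β := by
  have hg' (x : A) : g (i x) = j x := LinearMap.congr_fun hg x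
  have hpi (x : A) : p (i x) = 0 := h.exact.apply_apply_eq_zero x
  have hqj (x : A) : q (j x) = 0 := h₁.exact.apply_apply_eq_zero x
  have hba (x : Y) : b (a x) = 0 := h₂.exact.apply_apply_eq_zero x
  set κ := g.prod (a ∘ₗ p) with hκ
  -- If the second coordinate of `κ x` vanishes then `x` comes from `A`, where the first coordinate
  -- is the injective map `j`.
  have hs : IsShortExact κ (LinearMap.range κ).mkQ := isShortExact_range_mkQ κ (by
    rw [injective_iff_map_eq_zero]
    intro x hx
    have h1 : a (p x) = 0 := congrArg Prod.snd hx
    obtain ⟨y, rfl⟩ := (h.exact x).1 (h₂.injective (h1.trans (map_zero a).symm))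
    have h2 : g (i y) = 0 := congrArg Prod.fst hx
    rw [hg'] at h2
    rw [h₁.injective (h2.trans (map_zero j).symm), map_zero])
  obtain ⟨α, hα⟩ := h₁.exists_desc ((LinearMap.range κ).mkQ ∘ₗ LinearMap.inl R E F) (by
    ext x
    refine (hs.exact _).2 ⟨i x, ?_⟩
    simp [hκ, hg', hpi])
  obtain ⟨β, hβ⟩ := hs.exists_desc (b ∘ₗ LinearMap.snd R E F) (by
    ext x
    simp [hκ, hba])
  have hα' (x : E) : α (q x) = (LinearMap.range κ).mkQ (x, 0) := LinearMap.congr_fun hα x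
  have hβ' (x : E × F) : β ((LinearMap.range κ).mkQ x) = b x.2 := LinearMap.congr_fun hβ x
  refine ⟨_, α, β, hs, ?_, ?_, ?_⟩
  · rw [injective_iff_map_eq_zero]
    intro z hz
    obtain ⟨x, rfl⟩ := h₁.surjective z
    rw [hα'] at hz
    obtain ⟨m, hm⟩ := (hs.exact _).1 hz
    have h1 : a (p m) = 0 := congrArg Prod.snd hm
    obtain ⟨y, rfl⟩ := (h.exact m).1 (h₂.injective (h1.trans (map_zero a).symm))
    have h2 : g (i y) = x := congrArg Prod.fst hm
    rw [← h2, hg', hqj]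
  · intro z
    obtain ⟨⟨x, f⟩, rfl⟩ := hs.surjective z
    rw [hβ']
    constructor
    · intro hf
      obtain ⟨y, rfl⟩ := (h₂.exact f).1 hf
      obtain ⟨m, rfl⟩ := h.surjective y
      refine ⟨q (x - g m), ?_⟩
      rw [hα', ← sub_eq_zero, ← map_sub]
      exact (hs.exact _).2 ⟨-m, by simp [hκ]⟩
    · rintro ⟨c, hc⟩
      obtain ⟨y, rfl⟩ := h₁.surjective c
      have := congrArg β hc
      rw [hα', hβ', hβ'] at this
      simpa using this.symm
  · intro c
    obtain ⟨f, rfl⟩ := h₂.surjective c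
    exact ⟨_, hβ' (0, f)⟩

end Exactness

theorem CategoryTheory.Indecomposable.of_iso {M N : ModuleCat.{u} R} (h : Indecomposable M)
    (e : M ≅ N) : Indecomposable N :=
  ⟨fun hN => h.1 (hN.of_iso e), fun Y Z f => h.2 Y Z (e ≪≫ f)⟩

theorem directSumOf_pi {C : ModuleCat.{u} R → Prop} {s : ℕ} (N : Fin s → ModuleCat.{u} R)
    (h : ∀ i, C (N i)) : DirectSumOf C (ModuleCat.of R (∀ i, N i)) := by
  induction s with
  | zero => exact .zero _ inferInstance
  | succ s ih =>
    refine .step _ (N 0) _ ?_ (ih (fun i => N i.succ) fun i => h _) (h 0)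
    exact (LinearEquiv.prodComm R _ _).trans (Fin.consLinearEquiv R fun i => N i)

theorem DirectSumOf.flatten {C D : ModuleCat.{u} R → Prop} (h : ∀ X, C X → DirectSumOf D X)
    {M : ModuleCat.{u} R} (hM : DirectSumOf C M) : DirectSumOf D M := by
  induction hM with
  | zero M h => exact .zero M h
  | step A X M e hA hX ih => exact (ih.prod (h X hX)).of_equiv e

theorem DirectSumOf.extVanishes_right {C : ModuleCat.{u} R → Prop} {Y : Type u} [AddCommGroup Y]
    [Module R Y] (hC : ∀ X, C X → ExtVanishes R Y X) {M : ModuleCat.{u} R} (h : DirectSumOf C M) :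
    ExtVanishes R Y M :=
  (Filt.of_directSumOf h).extVanishes_right hC

/-- The conditions of a stratifying system in terms of linear maps. -/
structure IsStratified {t : ℕ} (X : Fin t → ModuleCat.{u} R) : Prop where
  finite : ∀ i, Module.Finite R (X i)
  indecomposable : ∀ i, Indecomposable (X i)
  hom_eq_zero : ∀ i j, i < j → ∀ f : X j →ₗ[R] X i, f = 0
  ext_eq_zero : ∀ i j, i ≤ j → ExtVanishes R (X j) (X i)

theorem IsStratifyingSystem.isStratified {t : ℕ} {X : Fin t → ModuleCat.{u} R}
    (h : IsStratifyingSystem X) : IsStratified X where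
  finite := h.finite
  indecomposable := h.indecomposable
  hom_eq_zero i j hij f := by
    have := h.hom_eq_zero i j hij (ModuleCat.ofHom f)
    exact congrArg ModuleCat.Hom.hom this
  ext_eq_zero i j hij := extVanishes_iff.2 (h.ext_eq_zero i j hij)

namespace IsStratified

variable {t : ℕ} {X : Fin t → ModuleCat.{u} R} (hX : IsStratified X)

include hX

theorem finite_of_filt {k : ℕ} {M : ModuleCat.{u} R} (h : Filt (FirstMembers X k) M) :
    Module.Finite R M := by
  refine h.finite ?_
  rintro Y ⟨i, -, ⟨e⟩⟩
  have := hX.finite i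
  exact Module.Finite.equiv e.symm

theorem extVanishes_of_filt {k : Fin t} {M : ModuleCat.{u} R}
    (h : Filt (FirstMembers X (k + 1)) M) : ExtVanishes R (X k) M := by
  refine h.extVanishes_right ?_
  rintro Y ⟨i, hi, ⟨e⟩⟩
  exact (hX.ext_eq_zero i k (Fin.le_def.2 (Nat.lt_succ_iff.1 hi))).of_retract_right
    e.toLinearMap e.symm.toLinearMap (by ext; simp)

theorem hom_eq_zero_of_filt {k : Fin t} {M : ModuleCat.{u} R}
    (h : Filt (FirstMembers X k) M) (f : X k →ₗ[R] M) : f = 0 := by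
  refine h.hom_eq_zero ?_ f
  rintro Y ⟨i, hi, ⟨e⟩⟩ g
  have := hX.hom_eq_zero i k hi (e.toLinearMap ∘ₗ g)
  ext x
  simpa using LinearMap.congr_fun this x

/-- A filtered module has a submodule collecting all copies of the last member. -/
theorem exists_isShortExact_top (k : Fin t) {M : ModuleCat.{u} R}
    (h : Filt (FirstMembers X (k + 1)) M) :
    ∃ (U M' : ModuleCat.{u} R) (i : U →ₗ[R] M) (p : M →ₗ[R] M'), IsShortExact i p ∧
      DirectSumOf (fun Y => Nonempty (Y ≃ₗ[R] X k)) U ∧ Filt (FirstMembers X k) M' := by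
  induction h with
  | zero M h =>
    exact ⟨ModuleCat.of R PUnit, M, 0, LinearMap.id, isShortExact_zero_id M,
      .zero _ inferInstance, .zero _ h⟩
  | step A M Y i p hs hA hY ih =>
    obtain ⟨U, A', a, b, hab, hU, hA'⟩ := ih
    obtain ⟨j, hj, ⟨e⟩⟩ := hY
    -- A factor of smaller index is absorbed into the quotient. A factor isomorphic to `X k` splits
    -- off, since Ext¹(X k, A) = 0, and joins `U`.
    rcases (Nat.lt_succ_iff.1 hj).lt_or_eq with hjk | hjk
    · obtain ⟨π, α, β, hπ, hαβ, -⟩ := hab.exists_comp hs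
      exact ⟨U, ModuleCat.of R _, _, π, hπ, hU,
        Filt.extension (M := ModuleCat.of R _) hαβ hA' (.single ⟨j, hjk, ⟨e⟩⟩)⟩
    · obtain rfl : j = k := Fin.ext hjk
      obtain ⟨r, hr⟩ := ((hX.extVanishes_of_filt hA).of_equiv_left e.symm).exists_retraction hs
      obtain ⟨f, -⟩ := hs.exists_equiv_prod r hr
      exact ⟨ModuleCat.of R (U × Y), A', _, _,
        (hab.prodMap_id (D := Y)).equiv_middle f.symm, hU.prod (.single ⟨e⟩), hA'⟩

/-- Let `U` be the submodule of copies of the last member. The idempotent of `M` defining `A`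
preserves `U`, so A ∩ U is a summand of `U`, and the image of `A` in M' = M / U is a summand of M'.
Krull–Schmidt handles the first, induction the second. -/
theorem filt_of_isRetractOf [IsNoetherianRing R] [IsArtinianRing R] {k : ℕ} (hk : k ≤ t)
    {M A : ModuleCat.{u} R} (h : Filt (FirstMembers X k) M) (hA : IsRetractOf R A M) :
    Filt (FirstMembers X k) A := by
  induction k generalizing M A with
  | zero =>
    have hM : Subsingleton M := by
      cases h with
      | zero _ h => exact h
      | step A M Y i p hs hA hY => obtain ⟨i, hi, -⟩ := hY; exact absurd hi (Nat.not_lt_zero _)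
    obtain ⟨i, r, hr⟩ := hA
    exact .zero _ (Function.LeftInverse.injective (LinearMap.congr_fun hr) :
      Function.Injective i).subsingleton
  | succ k ih =>
    obtain ⟨U, M', a, b, hab, hU, hM'⟩ := hX.exists_isShortExact_top ⟨k, hk⟩ h
    obtain ⟨i, r, hr⟩ := hA
    have hri (x : A) : r (i x) = x := LinearMap.congr_fun hr x
    -- This is where Hom(X k, M') = 0 enters.
    have h0 : b ∘ₗ i ∘ₗ r ∘ₗ a = 0 := by
      refine hU.hom_eq_zero ?_ _
      rintro Y ⟨e⟩ f
      have := hX.hom_eq_zero_of_filt hM' (f ∘ₗ e.symm.toLinearMap)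
      ext x
      simpa using LinearMap.congr_fun this (e x)
    have h0' (x : U) : b (i (r (a x))) = 0 := LinearMap.congr_fun h0 x
    have hs : IsShortExact (LinearMap.ker (b ∘ₗ i)).subtype (b ∘ₗ i).rangeRestrict :=
      { injective := Submodule.injective_subtype _
        exact := fun x => by simp [Subtype.ext_iff]
        surjective := LinearMap.surjective_rangeRestrict _ }
    have fU : Module.Finite R U := (Filt.of_directSumOf hU).finite (by
      rintro Y ⟨e⟩
      have := hX.finite ⟨k, hk⟩
      exact Module.Finite.equiv e.symm)
    have h1 : IsRetractOf R (LinearMap.ker (b ∘ₗ i)) U := by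
      obtain ⟨i', hi'⟩ := hab.exists_lift (i ∘ₗ (LinearMap.ker (b ∘ₗ i)).subtype) (by
        ext x; exact x.2)
      refine ⟨i', (r ∘ₗ a).codRestrict _ h0', ?_⟩
      ext x
      have : a (i' x) = i x := LinearMap.congr_fun hi' x
      exact (congrArg r this).trans (hri x)
    have h2 : IsRetractOf R (LinearMap.range (b ∘ₗ i)) M' := by
      obtain ⟨s, hs⟩ := hab.exists_desc ((b ∘ₗ i).rangeRestrict ∘ₗ r) (by
        ext x; exact h0' x)
      refine ⟨(LinearMap.range (b ∘ₗ i)).subtype, s, ?_⟩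
      ext ⟨_, x, rfl⟩
      have : s (b (i x)) = _ := LinearMap.congr_fun hs (i x)
      exact (congrArg Subtype.val this).trans (congrArg (b ∘ i) (hri x))
    have f1 : Module.Finite R (LinearMap.ker (b ∘ₗ i)) := h1.finite
    have d1 : DirectSumOf (fun Y => Nonempty (Y ≃ₗ[R] X ⟨k, hk⟩))
        (ModuleCat.of R (LinearMap.ker (b ∘ₗ i))) := by
      refine DirectSumOf.of_isRetractOf ?_ ?_ hU
        (N := ModuleCat.of R (LinearMap.ker (b ∘ₗ i))) h1
      · rintro Y ⟨e⟩
        exact (hX.indecomposable _).of_iso e.symm.toModuleIso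
      · rintro Y Z ⟨e⟩ ⟨e'⟩
        exact ⟨e'.trans e⟩
    have d2 := ih (Nat.le_of_succ_le hk) hM' (A := ModuleCat.of R (LinearMap.range (b ∘ₗ i))) h2
    refine Filt.extension (A := ModuleCat.of R _) (B := ModuleCat.of R _) hs
      ((Filt.of_directSumOf d1).mono ?_) (d2.mono ?_)
    · rintro Y ⟨e⟩
      exact ⟨⟨k, hk⟩, Nat.lt_succ_self k, ⟨e⟩⟩
    · rintro Y ⟨j, hj, e⟩
      exact ⟨j, hj.trans (Nat.lt_succ_self k), e⟩

end IsStratified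

end StratifyingSystems

/-! ### Universal extensions, Ext-injective envelopes and the module T. -/

section Envelopes

variable {R : Type u} [Ring R]

/-- The composition of a linear map with multiplication by a central element. -/
def centralSMul {K : Type*} [CommRing K] [Algebra K R] {A M : Type*} [AddCommGroup A] [Module R A]
    [AddCommGroup M] [Module R M] (c : K) (f : A →ₗ[R] M) : A →ₗ[R] M where
  toFun x := algebraMap K R c • f x
  map_add' x y := by rw [map_add, smul_add]
  map_smul' r x := by rw [map_smul, smul_smul, Algebra.commutes, ← smul_smul, RingHom.id_apply]

theorem exists_finite_spanning_homs (K : Type*) [Field K] [Algebra K R] [Module.Finite K R]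
    (A M : Type*) [AddCommGroup A] [Module R A] [AddCommGroup M] [Module R M]
    [Module.Finite R A] [Module.Finite R M] :
    ∃ (d : ℕ) (f : Fin d → A →ₗ[R] M), ∀ g : A →ₗ[R] M, ∃ c : Fin d → K,
      g = ∑ j, centralSMul (c j) (f j) := by
  let _ : Module K A := Module.compHom A (algebraMap K R)
  let _ : Module K M := Module.compHom M (algebraMap K R)
  have : IsScalarTower K R A := ⟨fun c r x => by
    rw [Algebra.smul_def, mul_smul]; rfl⟩
  have : IsScalarTower K R M := ⟨fun c r x => by
    rw [Algebra.smul_def, mul_smul]; rfl⟩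
  have : Module.Finite K A := Module.Finite.trans R A
  have : Module.Finite K M := Module.Finite.trans R M
  have : SMulCommClass R K M := IsScalarTower.to_smulCommClass'
  have : Module.Finite K (A →ₗ[R] M) :=
    Module.Finite.of_injective (LinearMap.restrictScalarsₗ K R A M K)
      (LinearMap.restrictScalars_injective K)
  obtain ⟨d, f, hf⟩ := Module.Finite.exists_fin (R := K) (M := A →ₗ[R] M)
  refine ⟨d, f, fun g => ?_⟩
  have hg : g ∈ Submodule.span K (Set.range f) := hf ▸ Submodule.mem_top
  obtain ⟨c, hc⟩ := (Submodule.mem_span_range_iff_exists_fun K).1 hg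
  exact ⟨c, hc.symm⟩

/-- The universal extension: a module embeds with cokernel a power of `X` into a module without
extensions by `X`. -/
theorem exists_universal_extension (K : Type*) [Field K] [Algebra K R] [Module.Finite K R]
    (X M : Type u) [AddCommGroup X] [Module R X] [AddCommGroup M] [Module R M]
    [Module.Finite R X] [Module.Finite R M] (hX : ExtVanishes R X X) :
    ∃ (d : ℕ) (E : ModuleCat.{u} R) (j : M →ₗ[R] E) (q : E →ₗ[R] (Fin d → X)),
      IsShortExact j q ∧ ExtVanishes R X E := by
  have : IsNoetherianRing R := IsNoetherianRing.of_finite K R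
  obtain ⟨m, p, hp⟩ := Module.Finite.exists_fin' R X
  have hs := isShortExact_ker p hp
  set i := (LinearMap.ker p).subtype
  obtain ⟨d, f, hf⟩ := exists_finite_spanning_homs (R := R) K (LinearMap.ker p) M
  -- The `f k` span Hom(ker p, M) over `K`. Pushing out along their sum makes each `f k`, viewed in
  -- `E`, extend to the free module, hence also every homomorphism ker p → M.
  obtain ⟨j, q, ψ, hjq, hψ⟩ := (hs.pi (ι := Fin d)).exists_pushout
    (LinearMap.lsum R (fun _ => LinearMap.ker p) ℕ f)
  refine ⟨d, ModuleCat.of R _, j, q, hjq, ?_⟩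
  have hψ' (k : Fin d) (x : LinearMap.ker p) : ψ (Pi.single k (i x)) = j (f k x) := by
    have := LinearMap.congr_fun hψ (Pi.single k x)
    have h1 : i.compLeft (Fin d) (Pi.single k x) = Pi.single k (i x) := by
      ext l : 1
      rcases eq_or_ne l k with rfl | h
      · simp
      · simp [h]
    rw [LinearMap.comp_apply, h1] at this
    rw [this, LinearMap.comp_apply]
    congr 1
    exact LinearMap.lsum_piSingle ..
  have hpow : ExtVanishes R X (Fin d → X) := extVanishes_pi _ fun _ => hX
  refine extVanishes_iff.2 (subsingleton_ext_of_projective hs fun h => ?_)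
  -- Ext¹(X, X^d) = 0 extends `q ∘ h` to the free module; subtracting a lift `w` of this extension
  -- corrects `h` to a map landing in `M`.
  obtain ⟨v, hv⟩ := hpow.extend hs (q ∘ₗ h)
  obtain ⟨w, hw⟩ := Module.projective_lifting_property q v hjq.surjective
  obtain ⟨h₀, hh₀⟩ := hjq.exists_lift (h - w ∘ₗ i) (by
    rw [LinearMap.comp_sub, ← LinearMap.comp_assoc, hw, hv, sub_self])
  obtain ⟨c, hc⟩ := hf h₀
  refine ⟨w + ∑ k, centralSMul (c k) (ψ ∘ₗ LinearMap.single R (fun _ => Fin m → R) k), ?_⟩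
  have hsum : (∑ k, centralSMul (c k) (ψ ∘ₗ LinearMap.single R (fun _ => Fin m → R) k)) ∘ₗ i =
      j ∘ₗ h₀ := by
    ext x
    rw [hc, LinearMap.comp_apply, LinearMap.comp_apply, LinearMap.sum_apply, LinearMap.sum_apply,
      map_sum]
    refine Finset.sum_congr rfl fun k _ => ?_
    have : j (algebraMap K R (c k) • f k x) = algebraMap K R (c k) • j (f k x) := map_smul ..
    exact (congrArg (algebraMap K R (c k) • ·) (hψ' k x)).trans this.symm
  rw [LinearMap.add_comp, hsum, hh₀, add_sub_cancel]

theorem Filt.flatten {C : ModuleCat.{u} R → Prop} {M : ModuleCat.{u} R} (h : Filt (Filt C) M) :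
    Filt C M := by
  induction h with
  | zero M h => exact .zero M h
  | step A M X i p hs hA hX ih => exact .extension hs ih hX

theorem isExtInjectiveFor_iff {t : ℕ} {X : Fin t → ModuleCat.{u} R}
    {M : ModuleCat.{u} R} :
    IsExtInjectiveFor X M ↔ Module.Finite R M ∧ ∀ k, ExtVanishes R (X k) M := by
  refine and_congr_right fun _ => ⟨fun h k => ?_, fun h N hN => ?_⟩
  · exact extVanishes_iff.2
      (h _ (isFilteredBy_of_filt (.single ⟨k, k.2, ⟨LinearEquiv.refl R _⟩⟩)))
  · refine extVanishes_iff.1 ((filt_of_isFilteredBy hN).extVanishes_left ?_)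
    rintro Y ⟨k, -, ⟨e⟩⟩
    exact (h k).of_equiv_left e.symm

theorem extVanishes_of_filt_left {t : ℕ} {X : Fin t → ModuleCat.{u} R}
    {N M : ModuleCat.{u} R} (hN : Filt (FirstMembers X t) N)
    (hM : ∀ k, ExtVanishes R (X k) M) : ExtVanishes R N M := by
  refine hN.extVanishes_left ?_
  rintro Y ⟨k, -, ⟨e⟩⟩
  exact (hM k).of_equiv_left e.symm

namespace IsStratified

variable {t : ℕ} {X : Fin t → ModuleCat.{u} R} (hX : IsStratified X)

include hX

/-- The members are treated by decreasing index. The universal extension by `X k₀` adds only copies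
of `X k₀`, and Ext¹(X k, X k₀) = 0 for k > k₀, so the vanishing reached before survives. -/
theorem exists_envelope (K : Type*) [Field K] [Algebra K R] [Module.Finite K R]
    {M : ModuleCat.{u} R} (hM : Filt (FirstMembers X t) M) :
    ∃ (E Z : ModuleCat.{u} R) (j : M →ₗ[R] E) (q : E →ₗ[R] Z), IsShortExact j q ∧
      Filt (FirstMembers X t) Z ∧ ∀ k, ExtVanishes R (X k) E := by
  have key : ∀ m ≤ t, ∃ (E Z : ModuleCat.{u} R) (j : M →ₗ[R] E) (q : E →ₗ[R] Z),
      IsShortExact j q ∧ Filt (FirstMembers X t) Z ∧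
      ∀ k : Fin t, t ≤ k + m → ExtVanishes R (X k) E := by
    intro m
    induction m with
    | zero =>
      intro _
      exact ⟨M, ModuleCat.of R PUnit, LinearMap.id, 0, isShortExact_id_zero _,
        .zero _ inferInstance, fun k hk => absurd hk (by omega)⟩
    | succ m ih =>
      intro hm
      obtain ⟨E, Z, j, q, hs, hZ, hE⟩ := ih (Nat.le_of_succ_le hm)
      let k₀ : Fin t := ⟨t - (m + 1), by omega⟩
      have := hX.finite k₀
      have : Module.Finite R E := hX.finite_of_filt (Filt.extension hs hM hZ)
      obtain ⟨d, E', j', q', hs', hE'⟩ :=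
        exists_universal_extension K (X k₀) E (hX.ext_eq_zero k₀ k₀ le_rfl)
      obtain ⟨π, α, β, hπ, hαβ, -⟩ := hs.exists_comp hs'
      have hpow : Filt (FirstMembers X t) (ModuleCat.of R (Fin d → X k₀)) :=
        .of_directSumOf (directSumOf_pi (fun _ => X k₀) fun _ =>
          ⟨k₀, k₀.2, ⟨LinearEquiv.refl R _⟩⟩)
      refine ⟨E', ModuleCat.of R _, _, π, hπ,
        Filt.extension (M := ModuleCat.of R _) (B := ModuleCat.of R (Fin d → X k₀)) hαβ hZ hpow,
        fun k hk => ?_⟩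
      rcases eq_or_ne k k₀ with rfl | hne
      · exact hE'
      · have hlt : k₀ < k := lt_of_le_of_ne (Fin.le_def.2 (by simp only [k₀]; omega)) hne.symm
        have : k₀.val < k.val := hlt
        refine .of_exact_right hs' (hE k (by simp only [k₀] at this; omega)) ?_
        exact extVanishes_pi _ fun _ => hX.ext_eq_zero k₀ k hlt.le
  obtain ⟨E, Z, j, q, h, hZ, hE⟩ := key t le_rfl
  exact ⟨E, Z, j, q, h, hZ, fun k => hE k (Nat.le_add_left _ _)⟩

theorem isFilteredBy_and_isExtInjectiveFor_iff {M : ModuleCat.{u} R} :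
    IsFilteredBy X M ∧ IsExtInjectiveFor X M ↔
      Filt (FirstMembers X t) M ∧ ∀ k, ExtVanishes R (X k) M := by
  rw [isExtInjectiveFor_iff]
  exact ⟨fun h => ⟨filt_of_isFilteredBy h.1, h.2.2⟩,
    fun h => ⟨isFilteredBy_of_filt h.1, hX.finite_of_filt h.1, h.2⟩⟩

/-- The Ext-injective filtered modules are, up to isomorphism, the direct sums of finitely many
pairwise non-isomorphic indecomposable ones. -/
theorem exists_indecomposables (K : Type*) [Field K] [Algebra K R] [Module.Finite K R] :
    ∃ (s : ℕ) (N : Fin s → ModuleCat.{u} R), (∀ i, Indecomposable (N i)) ∧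
      (∀ i j, i ≠ j → IsEmpty (N i ≅ N j)) ∧
      (∀ i, Filt (FirstMembers X t) (N i) ∧ ∀ k, ExtVanishes R (X k) (N i)) ∧
      ∀ M : ModuleCat.{u} R, Filt (FirstMembers X t) M → (∀ k, ExtVanishes R (X k) M) →
        DirectSumOf (fun Y => ∃ i, Nonempty (Y ≃ₗ[R] N i)) M := by
  have : IsNoetherianRing R := IsNoetherianRing.of_finite K R
  have : IsArtinianRing R := IsArtinianRing.of_finite K R
  choose Y Z a b hab hZ hY using fun i => hX.exists_envelope K (M := X i)
    (.single ⟨i, i.2, ⟨LinearEquiv.refl R _⟩⟩)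
  have hYF (i) : Filt (FirstMembers X t) (Y i) :=
    .extension (hab i) (.single ⟨i, i.2, ⟨LinearEquiv.refl R _⟩⟩) (hZ i)
  -- Horseshoe over the filtration: the embedding of `A` extends to `M` because the envelopes are
  -- Ext-injective, and is completed by the envelope of the top factor.
  have embed : ∀ M : ModuleCat.{u} R, Filt (FirstMembers X t) M →
      ∃ (E Z : ModuleCat.{u} R) (j : M →ₗ[R] E) (q : E →ₗ[R] Z), IsShortExact j q ∧
        Filt (FirstMembers X t) Z ∧ DirectSumOf (fun W => ∃ i, Nonempty (W ≃ₗ[R] Y i)) E := by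
    intro M hM
    induction hM with
    | zero M h =>
      exact ⟨M, ModuleCat.of R PUnit, LinearMap.id, 0, isShortExact_id_zero _,
        .zero _ inferInstance, .zero _ h⟩
    | step A M X' i p hs hA hX' ih =>
      obtain ⟨E, Z₁, j, q, hjq, hZ₁, hE⟩ := ih
      obtain ⟨k, -, ⟨e⟩⟩ := hX'
      have hEX : ExtVanishes R X' E := by
        refine hE.extVanishes_right ?_
        rintro W ⟨l, ⟨f⟩⟩
        exact ((hY l k).of_equiv_left e.symm).of_retract_right f.toLinearMap f.symm.toLinearMap
          (by ext; simp)
      obtain ⟨g, hg⟩ := hEX.extend hs j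
      obtain ⟨π, α, β, hπ, hαβ⟩ := hs.exists_horseshoe hjq ((hab k).equiv_left e) g hg
      exact ⟨ModuleCat.of R (E × Y k), ModuleCat.of R _, _, π, hπ,
        Filt.extension (M := ModuleCat.of R _) hαβ hZ₁ (hZ k),
        hE.prod (.single ⟨k, ⟨LinearEquiv.refl R _⟩⟩)⟩
  let T := ModuleCat.of R (∀ i, Y i)
  have hT : Filt (FirstMembers X t) T :=
    Filt.of_directSumOf (C := Filt (FirstMembers X t)) (directSumOf_pi Y hYF) |>.flatten
  have hTX (k) : ExtVanishes R (X k) T := extVanishes_pi _ fun i => hY i k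
  have : Module.Finite R T := hX.finite_of_filt hT
  obtain ⟨m, N, hN, ⟨eT⟩⟩ := (directSumOf_indecomposable T).exists_equiv_pi
  -- One representative is kept from each isomorphism class of indecomposable summands of `T`.
  let S : Setoid (Fin m) :=
    { r := fun i j => Nonempty (N i ≅ N j)
      iseqv := ⟨fun i => ⟨Iso.refl _⟩, fun ⟨e⟩ => ⟨e.symm⟩, fun ⟨e⟩ ⟨f⟩ => ⟨e ≪≫ f⟩⟩ }
  obtain ⟨s, ⟨σ⟩⟩ := Finite.exists_equiv_fin (Quotient S)
  have hC : DirectSumOf (fun W => ∃ i, Nonempty (W ≃ₗ[R] N (σ.symm i).out)) T := by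
    refine DirectSumOf.of_equiv (M := ModuleCat.of R (∀ i, N i)) (directSumOf_pi N fun i => ?_)
      eT.symm
    refine ⟨σ (Quotient.mk S i), ?_⟩
    rw [σ.symm_apply_apply]
    obtain ⟨e⟩ : Nonempty (N (Quotient.mk S i).out ≅ N i) :=
      Quotient.exact (Quotient.out_eq (Quotient.mk S i))
    exact ⟨e.symm.toLinearEquiv⟩
  have retract : ∀ {E M : ModuleCat.{u} R}, Module.Finite R M → IsRetractOf R M E →
      DirectSumOf (fun W => ∃ i, Nonempty (W ≃ₗ[R] N (σ.symm i).out)) E →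
      DirectSumOf (fun W => ∃ i, Nonempty (W ≃ₗ[R] N (σ.symm i).out)) M := by
    intro E M _ hM hE
    refine hE.of_isRetractOf ?_ ?_ hM
    · rintro W ⟨i, ⟨e⟩⟩
      exact (hN _).1.of_iso e.symm.toModuleIso
    · rintro W V ⟨i, ⟨e⟩⟩ ⟨f⟩
      exact ⟨i, ⟨f.trans e⟩⟩
  refine ⟨s, fun i => N (σ.symm i).out, fun i => (hN _).1, fun i j hij => ⟨fun e => hij ?_⟩,
    fun i => ⟨?_, fun k => ?_⟩, fun M hM hMX => ?_⟩
  · exact σ.symm.injective (Quotient.out_equiv_out.1 ⟨e⟩)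
  · exact hX.filt_of_isRetractOf le_rfl hT (hN _).2
  · obtain ⟨a, r, hr⟩ := (hN (σ.symm i).out).2
    exact (hTX k).of_retract_right a r hr
  · obtain ⟨E, Z', j, q, hjq, hZ', hE⟩ := embed M hM
    -- The cokernel is filtered and `M` is Ext-injective, so the embedding splits.
    obtain ⟨r, hr⟩ := (extVanishes_of_filt_left hZ' hMX).exists_retraction hjq
    refine retract (hX.finite_of_filt hM) ⟨j, r, hr⟩ (hE.flatten ?_)
    rintro W ⟨i, ⟨e⟩⟩
    have : Module.Finite R (Y i) := hX.finite_of_filt (hYF i)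
    exact (retract inferInstance (isRetractOf_pi (fun i => Y i) i) hC).of_equiv e.symm

/-- The Ext-injective filtered modules form the additive closure of a basic module without
self-extensions. -/
theorem exists_basic (K : Type*) [Field K] [Algebra K R] [Module.Finite K R] :
    ∃ T : ModuleCat.{u} R, Module.Finite R T ∧ Subsingleton (Abelian.Ext T T 1) ∧
      IsBasicModule T ∧
      ∀ M : ModuleCat.{u} R, (IsFilteredBy X M ∧ IsExtInjectiveFor X M) ↔ InAdd T M := by
  have : IsNoetherianRing R := IsNoetherianRing.of_finite K R
  have : IsArtinianRing R := IsArtinianRing.of_finite K R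
  obtain ⟨s, N, hind, hiso, hN, hM⟩ := hX.exists_indecomposables K
  have hpi : ∀ {m : ℕ} (L : Fin m → ModuleCat.{u} R), (∀ i, Filt (FirstMembers X t) (L i)) →
      (∀ i k, ExtVanishes R (X k) (L i)) →
      Filt (FirstMembers X t) (⨁ L) ∧ ∀ k, ExtVanishes R (X k) (⨁ L : ModuleCat.{u} R) := by
    intro m L h1 h2
    let e := (ModuleCat.biproductIsoPi L).toLinearEquiv
    refine ⟨?_, fun k => (extVanishes_pi (fun i => L i) (h2 · k)).of_retract_right
      e.toLinearMap e.symm.toLinearMap (by ext; simp)⟩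
    exact (Filt.of_directSumOf (C := Filt (FirstMembers X t)) (directSumOf_pi L h1)).flatten.of_equiv
      e.symm
  obtain ⟨hT, hTX⟩ := hpi N (fun i => (hN i).1) fun i => (hN i).2
  refine ⟨⨁ N, hX.finite_of_filt hT, extVanishes_iff.1 (extVanishes_of_filt_left hT hTX),
    ⟨s, N, hind, hiso, ⟨Iso.refl _⟩⟩, fun M => ?_⟩
  rw [hX.isFilteredBy_and_isExtInjectiveFor_iff]
  constructor
  · rintro ⟨h1, h2⟩
    obtain ⟨m, L, hL, ⟨e⟩⟩ := (hM M h1 h2).exists_equiv_pi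
    refine ⟨m, L, fun i => ?_, ⟨e.toModuleIso ≪≫ (ModuleCat.biproductIsoPi L).symm⟩⟩
    obtain ⟨j, ⟨f⟩⟩ := hL i
    obtain ⟨a, r, hr⟩ := (f.isRetractOf.trans (isRetractOf_pi (fun i => N i) j)).trans
      (ModuleCat.biproductIsoPi N).symm.toLinearEquiv.isRetractOf
    exact ⟨ModuleCat.of R (LinearMap.ker r), ⟨(retractEquivProd a r hr).toModuleIso ≪≫
      (ModuleCat.biprodIsoProd (L i) (ModuleCat.of R (LinearMap.ker r))).symm⟩⟩
  · rintro ⟨m, L, hL, ⟨e⟩⟩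
    have hL' (i) : IsRetractOf R (L i) (⨁ N : ModuleCat.{u} R) := by
      obtain ⟨C, ⟨f⟩⟩ := hL i
      exact isRetractOf_prod_left.trans
        (f ≪≫ ModuleCat.biprodIsoProd _ _).symm.toLinearEquiv.isRetractOf
    obtain ⟨h1, h2⟩ := hpi L (fun i => hX.filt_of_isRetractOf le_rfl hT (hL' i)) fun i k => by
      obtain ⟨a, r, hr⟩ := hL' i
      exact (hTX k).of_retract_right a r hr
    exact ⟨h1.of_equiv e.symm.toLinearEquiv, fun k => (h2 k).of_retract_right
      e.toLinearEquiv.toLinearMap e.symm.toLinearEquiv.toLinearMap (by ext; simp)⟩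

end IsStratified

end Envelopes

/-! ### Derivations as cocycles of extensions. -/

section Derivations

/-- Additive maps `D` from `R` to `Hom (X, N)` with `D (r s) = r D s + (D r) s`. -/
structure ModuleDerivation (R X N : Type*) [Ring R] [AddCommGroup X] [Module R X] [AddCommGroup N]
    [Module R N] where
  /-- The underlying additive map. -/
  toFun : R →+ X →+ N
  leibniz : ∀ r s x, toFun (r * s) x = r • toFun s x + toFun r (s • x)

namespace ModuleDerivation

variable {R X N : Type*} [Ring R] [AddCommGroup X] [Module R X] [AddCommGroup N] [Module R N]

theorem map_one_apply (D : ModuleDerivation R X N) (x : X) : D.toFun 1 x = 0 := by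
  have := D.leibniz 1 1 x
  rw [mul_one, one_smul, one_smul] at this
  exact left_eq_add.1 this

/-- The extension of `X` by `N` with cocycle `D`. -/
def Extension (_ : ModuleDerivation R X N) : Type _ := N × X

instance (D : ModuleDerivation R X N) : AddCommGroup D.Extension :=
  inferInstanceAs (AddCommGroup (N × X))

instance (D : ModuleDerivation R X N) : Module R D.Extension where
  smul r y := (r • y.1 + D.toFun r y.2, r • y.2)
  one_smul y := Prod.ext (by
    change (1 : R) • y.1 + D.toFun 1 y.2 = y.1
    rw [D.map_one_apply, one_smul, add_zero]) (one_smul R y.2)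
  mul_smul r s y := Prod.ext (by
    change (r * s) • y.1 + D.toFun (r * s) y.2 =
      r • (s • y.1 + D.toFun s y.2) + D.toFun r (s • y.2)
    rw [D.leibniz, mul_smul, smul_add, add_assoc]) (mul_smul r s y.2)
  smul_zero r := Prod.ext (by
    change r • (0 : N) + D.toFun r 0 = 0
    rw [smul_zero, map_zero, add_zero]) (smul_zero r)
  smul_add r y z := Prod.ext (by
    change r • (y.1 + z.1) + D.toFun r (y.2 + z.2) =
      (r • y.1 + D.toFun r y.2) + (r • z.1 + D.toFun r z.2)
    rw [smul_add, map_add]; abel) (smul_add r y.2 z.2)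
  add_smul r s y := Prod.ext (by
    change (r + s) • y.1 + D.toFun (r + s) y.2 =
      (r • y.1 + D.toFun r y.2) + (s • y.1 + D.toFun s y.2)
    rw [add_smul, map_add, AddMonoidHom.add_apply]; abel) (add_smul r s y.2)
  zero_smul y := Prod.ext (by
    change (0 : R) • y.1 + D.toFun 0 y.2 = 0
    rw [zero_smul, map_zero, AddMonoidHom.zero_apply, add_zero]) (zero_smul R y.2)

/-- The inclusion of the submodule of the extension. -/
def inl (D : ModuleDerivation R X N) : N →ₗ[R] D.Extension where
  toFun y := ((y, 0) : N × X)
  map_add' y z := Prod.ext rfl (add_zero (0 : X)).symm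
  map_smul' r y := Prod.ext (by
    change r • y = r • y + D.toFun r 0
    rw [map_zero, add_zero]) (smul_zero r).symm

/-- The projection of the extension to its quotient. -/
def snd (D : ModuleDerivation R X N) : D.Extension →ₗ[R] X where
  toFun y := y.2
  map_add' _ _ := rfl
  map_smul' _ _ := rfl

theorem isShortExact (D : ModuleDerivation R X N) : IsShortExact D.inl D.snd where
  injective _ _ h := congrArg Prod.fst h
  exact y := ⟨fun h => ⟨y.1, Prod.ext rfl h.symm⟩, by rintro ⟨z, rfl⟩; rfl⟩
  surjective x := ⟨((0, x) : N × X), rfl⟩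

/-- If extensions vanish then every derivation is inner. -/
theorem exists_inner {X N : Type u} {R : Type u} [Ring R] [AddCommGroup X] [Module R X]
    [AddCommGroup N] [Module R N] (D : ModuleDerivation R X N) (h : ExtVanishes R X N) :
    ∃ f : X →+ N, ∀ r x, f (r • x) = r • f x + D.toFun r x := by
  obtain ⟨ρ, hρ⟩ := h.exists_retraction D.isShortExact
  have hρ' (y : N) : ρ (D.inl y) = y := LinearMap.congr_fun hρ y
  -- The additive section x ↦ (0, x) fails to be linear exactly by `D`; composing it with the
  -- retraction exhibits `D` as inner, up to the sign.
  let j : X →+ D.Extension := AddMonoidHom.inr N X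
  refine ⟨-(ρ.toAddMonoidHom.comp j), fun r x => ?_⟩
  have h1 : r • j x = D.inl (D.toFun r x) + j (r • x) := Prod.ext (by
    change r • (0 : N) + D.toFun r x = D.toFun r x + 0
    rw [smul_zero, zero_add, add_zero]) (zero_add _).symm
  have h2 := congrArg ρ h1
  rw [map_smul, map_add, hρ'] at h2
  change -ρ (j (r • x)) = r • (-ρ (j x)) + D.toFun r x
  rw [smul_neg, h2]; abel

/-- Derivations become inner on a projective module. -/
theorem exists_inner_of_projective (D : ModuleDerivation R X N) {P : Type*} [AddCommGroup P]
    [Module R P] [Module.Projective R P] (π : P →ₗ[R] X) :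
    ∃ f : P →+ N, ∀ r x, f (r • x) = r • f x + D.toFun r (π x) := by
  obtain ⟨l, hl⟩ := Module.projective_lifting_property D.snd π D.isShortExact.surjective
  have hl' (x : P) : (l x).2 = π x := LinearMap.congr_fun hl x
  let q : D.Extension →+ N := AddMonoidHom.fst N X
  refine ⟨q.comp l.toAddMonoidHom, fun r x => ?_⟩
  change (l (r • x)).1 = r • (l x).1 + D.toFun r (π x)
  rw [map_smul, ← hl']; rfl

end ModuleDerivation

end Derivations

/-! ### Path actions and derivations prescribed on arrows. -/

namespace PathAlgebra

section

variable (K : Type u) [Field K] {V : Type v} [Quiver.{w} V]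

theorem induction_on {P : PathAlgebra K V → Prop} (f : PathAlgebra K V) (zero : P 0)
    (add : ∀ f g, P f → P g → P (f + g)) (smul_of : ∀ (c : K) x, P (c • of K x)) : P f := by
  refine Finsupp.induction_linear (motive := P) f zero (fun f g => add f g) fun x c => ?_
  have : (Finsupp.single x c : PathAlgebra K V) = c • of K x := by
    rw [of]
    exact (Finsupp.smul_single_one x c).symm
  rw [this]
  exact smul_of c x

variable [Fintype V]

section Action

variable (V) in
/-- The opposite of the path algebra, whose modules are the right modules. -/
abbrev Opp : Type (max u v w) := (PathAlgebra K V)ᵐᵒᵖ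

variable (X : Type*) [AddCommGroup X] [Module K X] [Module (Opp K V) X]
  [IsScalarTower K (Opp K V) X]

/-- The right action of a path on a module. -/
noncomputable def act {a b : V} (p : Quiver.Path a b) : X →ₗ[K] X where
  toFun x := MulOpposite.op (of K ⟨a, b, p⟩) • x
  map_add' := smul_add _
  map_smul' c x := smul_algebra_smul_comm c (MulOpposite.op (of K ⟨a, b, p⟩)) x

variable {X}

theorem op_of_smul (y : QuiverPaths V) (x : X) :
    MulOpposite.op (of K y) • x = act K X y.2.2 x := rfl

theorem op_smul_of_smul (c : K) (y : QuiverPaths V) (x : X) :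
    MulOpposite.op (c • of K y) • x = c • act K X y.2.2 x := by
  rw [MulOpposite.op_smul, smul_assoc, op_of_smul]

theorem act_comp {a b c : V} (p : Quiver.Path a b) (q : Quiver.Path b c) (x : X) :
    act K X (p.comp q) x = act K X q (act K X p x) := by
  change _ = MulOpposite.op (of K ⟨b, c, q⟩) • MulOpposite.op (of K ⟨a, b, p⟩) • x
  rw [← mul_smul, ← MulOpposite.op_mul, of_mul_of, pathMul_comp]; rfl

theorem act_act_of_ne {a b c d : V} (p : Quiver.Path a b) (q : Quiver.Path c d) (h : c ≠ b)
    (x : X) : act K X q (act K X p x) = 0 := by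
  change MulOpposite.op (of K ⟨c, d, q⟩) • MulOpposite.op (of K ⟨a, b, p⟩) • x = 0
  rw [← mul_smul, ← MulOpposite.op_mul, of_mul_of, pathMul_of_ne K (by exact h),
    MulOpposite.op_zero, zero_smul]

theorem act_cons {a b c : V} (p : Quiver.Path a b) (e : b ⟶ c) (x : X) :
    act K X (p.cons e) x = act K X e.toPath (act K X p x) :=
  act_comp K p e.toPath x

theorem act_act_nil {a b : V} (p : Quiver.Path a b) (x : X) :
    act K X p (act K X (.nil : Quiver.Path a a) x) = act K X p x := by
  rw [← act_comp, Quiver.Path.nil_comp]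

theorem act_nil_act {a b : V} (p : Quiver.Path a b) (x : X) :
    act K X (.nil : Quiver.Path b b) (act K X p x) = act K X p x := by
  rw [← act_comp, Quiver.Path.comp_nil]

theorem sum_act_nil (x : X) : ∑ a : V, act K X (.nil : Quiver.Path a a) x = x := by
  have : MulOpposite.op (1 : PathAlgebra K V) • x = x := one_smul _ x
  rw [one_def, Finset.op_sum, Finset.sum_smul] at this
  exact this

theorem act_map {Y : Type*} [AddCommGroup Y] [Module K Y] [Module (Opp K V) Y]
    [IsScalarTower K (Opp K V) Y] (f : X →ₗ[Opp K V] Y) {a b : V} (p : Quiver.Path a b) (x : X) :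
    f (act K X p x) = act K Y p (f x) := map_smul f (MulOpposite.op (of K ⟨a, b, p⟩)) x

/-- A linear map that commutes with trivial paths and arrows is linear over the path algebra. -/
theorem map_smul_of_arrows {Y : Type*} [AddCommGroup Y] [Module K Y] [Module (Opp K V) Y]
    [IsScalarTower K (Opp K V) Y] (f : X →ₗ[K] Y)
    (hv : ∀ (a : V) x, f (act K X (.nil : Quiver.Path a a) x) = act K Y (.nil : Quiver.Path a a) (f x))
    (he : ∀ {a b : V} (e : a ⟶ b) x, f (act K X e.toPath x) = act K Y e.toPath (f x))
    (r : Opp K V) (x : X) : f (r • x) = r • f x := by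
  have hp : ∀ {a b : V} (p : Quiver.Path a b) x, f (act K X p x) = act K Y p (f x) := by
    intro a b p
    induction p with
    | nil => exact hv a
    | cons p e ih => intro x; rw [act_cons, act_cons, he, ih]
  obtain ⟨r, rfl⟩ := MulOpposite.op_surjective r
  induction r using induction_on with
  | zero => simp
  | add r s hr hs => rw [MulOpposite.op_add, add_smul, add_smul, map_add, hr, hs]
  | smul_of c y => rw [op_smul_of_smul, op_smul_of_smul, map_smul, hp]

end Action

section Derivation

variable {X N : Type*} [AddCommGroup X] [Module K X] [Module (Opp K V) X]
  [IsScalarTower K (Opp K V) X] [AddCommGroup N] [Module K N] [Module (Opp K V) N]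
  [IsScalarTower K (Opp K V) N]

variable (g : ∀ {a b : V}, (a ⟶ b) → X →ₗ[K] N)

/-- The values on paths of the derivation with given values on arrows. -/
noncomputable def pathDeriv {a : V} : ∀ {b : V}, Quiver.Path a b → X →ₗ[K] N
  | _, .nil => 0
  | _, .cons p e => act K N e.toPath ∘ₗ pathDeriv p + g e ∘ₗ act K X p

theorem pathDeriv_cons {a b c : V} (p : Quiver.Path a b) (e : b ⟶ c) (x : X) :
    pathDeriv K g (p.cons e) x =
      act K N e.toPath (pathDeriv K g p x) + g e (act K X p x) := rfl

/-- The linear map on the path algebra extending `pathDeriv`. -/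
noncomputable def derivLin : PathAlgebra K V →ₗ[K] X →ₗ[K] N :=
  Finsupp.linearCombination K fun y : QuiverPaths V => pathDeriv K g y.2.2

theorem derivLin_of (y : QuiverPaths V) : derivLin K g (of K y) = pathDeriv K g y.2.2 := by
  rw [derivLin, of]
  erw [Finsupp.linearCombination_single, one_smul]

theorem pathDeriv_act_nil {a b : V} (p : Quiver.Path a b) (x : X) :
    pathDeriv K g p (act K X (.nil : Quiver.Path a a) x) = pathDeriv K g p x := by
  induction p with
  | nil => rfl
  | cons p e ih => rw [pathDeriv_cons, pathDeriv_cons, ih, act_act_nil]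

variable {g} (hg : ∀ {a b : V} (e : a ⟶ b) x, act K N (.nil : Quiver.Path b b) (g e x) = g e x)

include hg in
theorem act_nil_pathDeriv {a b : V} (p : Quiver.Path a b) (x : X) :
    act K N (.nil : Quiver.Path b b) (pathDeriv K g p x) = pathDeriv K g p x := by
  cases p with
  | nil => exact map_zero _
  | cons p e => rw [pathDeriv_cons, map_add, act_nil_act, hg]

include hg in
theorem pathDeriv_comp {a b c : V} (p : Quiver.Path a b) (q : Quiver.Path b c) (x : X) :
    pathDeriv K g (p.comp q) x =
      act K N q (pathDeriv K g p x) + pathDeriv K g q (act K X p x) := by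
  induction q with
  | nil =>
    rw [Quiver.Path.comp_nil, act_nil_pathDeriv K hg]
    exact (add_zero _).symm
  | cons q e ih =>
    rw [Quiver.Path.comp_cons, pathDeriv_cons, pathDeriv_cons, ih, map_add, act_cons, act_comp,
      add_assoc]

include hg in
-- This is the Leibniz rule for right modules, whence the reversed order of the factors; bilinearity
-- reduces it to paths.
theorem derivLin_mul (r s : PathAlgebra K V) (x : X) :
    derivLin K g (r * s) x =
      MulOpposite.op s • derivLin K g r x + derivLin K g s (MulOpposite.op r • x) := by
  induction r using induction_on with
  | zero => simp
  | add r r' hr hr' =>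
    rw [add_mul, map_add, map_add, LinearMap.add_apply, LinearMap.add_apply, hr, hr', smul_add,
      MulOpposite.op_add, add_smul, map_add]
    abel
  | smul_of c y =>
    induction s using induction_on with
    | zero => simp
    | add s s' hs hs' =>
      rw [mul_add, map_add, map_add, LinearMap.add_apply, LinearMap.add_apply, hs, hs',
        MulOpposite.op_add, add_smul]
      abel
    | smul_of d z =>
      rw [op_smul_of_smul, op_smul_of_smul, smul_mul_smul_comm, map_smul, map_smul, map_smul,
        map_smul, derivLin_of, derivLin_of, LinearMap.smul_apply, LinearMap.smul_apply,
        LinearMap.smul_apply, map_smul, of_mul_of, smul_smul, smul_smul, mul_comm d c, ← smul_add]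
      congr 1
      obtain ⟨a, b, p⟩ := y
      obtain ⟨b', c, q⟩ := z
      by_cases h : b' = b
      · subst h
        rw [pathMul_comp, derivLin_of]
        exact pathDeriv_comp K hg p q x
      · rw [pathMul_of_ne K (by exact h), map_zero, LinearMap.zero_apply]
        dsimp only
        -- For non-composable paths both terms vanish: the derivative of `p` takes values at the
        -- target of `p`, and that of `q` sees only the source of `q`.
        rw [← act_nil_pathDeriv K hg p, act_act_of_ne K _ _ h, ← pathDeriv_act_nil K _ q,
          act_act_of_ne K _ _ h, map_zero, zero_add]

/-- The derivation with given values on arrows that vanishes on trivial paths. -/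
noncomputable def arrowDerivation : ModuleDerivation (Opp K V) X N where
  toFun :=
    { toFun := fun r => (derivLin K g r.unop).toAddMonoidHom
      map_zero' := by ext x; simp
      map_add' := fun r s => by ext x; simp }
  leibniz r s x := by
    have := derivLin_mul K hg s.unop r.unop x
    exact this

theorem arrowDerivation_apply (y : QuiverPaths V) (x : X) :
    (arrowDerivation K hg).toFun (MulOpposite.op (of K y)) x = pathDeriv K g y.2.2 x := by
  change derivLin K g (of K y) x = _
  rw [derivLin_of]

theorem arrowDerivation_smul (c : K) (y : QuiverPaths V) (x : X) :
    (arrowDerivation K hg).toFun (MulOpposite.op (c • of K y)) x =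
      c • pathDeriv K g y.2.2 x := by
  change derivLin K g (c • of K y) x = _
  rw [map_smul, derivLin_of, LinearMap.smul_apply]

end Derivation

end

end PathAlgebra

/-! ### The Euler form and the bound on the size of a stratifying system. -/

namespace PathAlgebra

section

variable (K : Type u) [Field K] {V : Type v} [Quiver.{w} V] [Fintype V]

section Euler

/-- The arrows of a quiver, with source and target. -/
abbrev Arrows (V : Type v) [Quiver.{w} V] : Type (max v w) := Σ a : V, Σ b : V, a ⟶ b

section VertexSpaces

variable (X : Type*) [AddCommGroup X] [Module K X] [Module (Opp K V) X]
  [IsScalarTower K (Opp K V) X]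

/-- The vector space of a module at a vertex. -/
noncomputable abbrev vertexSpace (a : V) : Submodule K X :=
  LinearMap.range (act K X (.nil : Quiver.Path a a))

variable {X}

theorem act_nil_of_mem {a : V} {x : X} (hx : x ∈ vertexSpace K X a) :
    act K X (.nil : Quiver.Path a a) x = x := by
  obtain ⟨y, rfl⟩ := hx
  exact act_nil_act K _ y

theorem act_mem {a b : V} (p : Quiver.Path a b) (x : X) : act K X p x ∈ vertexSpace K X b :=
  ⟨_, act_nil_act K p x⟩

variable (X)

/-- The linear map between vertex spaces given by an arrow. -/
noncomputable def arrowMap {a b : V} (e : a ⟶ b) : vertexSpace K X a →ₗ[K] vertexSpace K X b :=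
  (act K X e.toPath).restrict fun x _ => act_mem K e.toPath x

variable (N : Type*) [AddCommGroup N] [Module K N] [Module (Opp K V) N]
  [IsScalarTower K (Opp K V) N]

/-- The map whose kernel is the space of homomorphisms and whose cokernel is the first extension
group. -/
noncomputable def homDifferential :
    (∀ a : V, vertexSpace K X a →ₗ[K] vertexSpace K N a) →ₗ[K]
      ∀ e : Arrows V, vertexSpace K X e.1 →ₗ[K] vertexSpace K N e.2.1 where
  toFun f e := f e.2.1 ∘ₗ arrowMap K X e.2.2 - arrowMap K N e.2.2 ∘ₗ f e.1
  map_add' f g := by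
    ext e x : 3
    simp only [Pi.add_apply, LinearMap.sub_apply, LinearMap.comp_apply, LinearMap.add_apply,
      map_add, add_sub_add_comm]
  map_smul' c f := by
    ext e x : 3
    simp only [Pi.smul_apply, LinearMap.sub_apply, LinearMap.comp_apply, LinearMap.smul_apply,
      map_smul, smul_sub, RingHom.id_apply]

variable {X N}

theorem homDifferential_apply (f : ∀ a : V, vertexSpace K X a →ₗ[K] vertexSpace K N a)
    (e : Arrows V) (x : vertexSpace K X e.1) :
    (homDifferential K (V := V) X N f e x : N) =
      f e.2.1 ⟨act K X e.2.2.toPath x, act_mem K _ _⟩ - act K N e.2.2.toPath (f e.1 x) := rfl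

/-- A family of vertex maps in the kernel commutes with the arrows, so its sum over the vertices is
a module homomorphism. -/
theorem ker_homDifferential_eq_bot (h : ∀ f : X →ₗ[Opp K V] N, f = 0) :
    LinearMap.ker (homDifferential K (V := V) X N) = ⊥ := by
  classical
  rw [LinearMap.ker_eq_bot']
  intro f hf
  let F : X →ₗ[K] N := ∑ a : V, (vertexSpace K N a).subtype ∘ₗ f a ∘ₗ
    (act K X (.nil : Quiver.Path a a)).rangeRestrict
  have hF {a : V} (x : vertexSpace K X a) : F x = f a x := by
    rw [LinearMap.sum_apply, Finset.sum_eq_single a]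
    · have : (act K X (.nil : Quiver.Path a a)).rangeRestrict x = x :=
        Subtype.ext (act_nil_of_mem K x.2)
      simp [this]
    · intro b _ hb
      have : (act K X (.nil : Quiver.Path b b)).rangeRestrict x = 0 := by
        refine Subtype.ext ?_
        change act K X (.nil : Quiver.Path b b) x = 0
        rw [← act_nil_of_mem K x.2]
        exact act_act_of_ne K _ _ hb _
      simp [this]
    · simp
  have hFv (a : V) (x : X) : F (act K X (.nil : Quiver.Path a a) x) =
      act K N (.nil : Quiver.Path a a) (F x) := by
    have h1 : ∀ b : V, act K N (.nil : Quiver.Path a a)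
        (F (act K X (.nil : Quiver.Path b b) x)) =
        if b = a then F (act K X (.nil : Quiver.Path a a) x) else 0 := by
      intro b
      have h2 := hF ⟨act K X (.nil : Quiver.Path b b) x, act_mem K _ x⟩
      simp only at h2
      rw [h2]
      split_ifs with hb
      · subst hb
        rw [h2]
        exact act_nil_of_mem K (f b _).2
      · rw [← act_nil_of_mem K (f b _).2]
        exact act_act_of_ne K _ _ (Ne.symm hb) _
    conv_rhs => rw [← sum_act_nil K (V := V) x, map_sum, map_sum]
    rw [Finset.sum_congr rfl fun b _ => h1 b]
    simp
  have hFe {a b : V} (e : a ⟶ b) (x : X) : F (act K X e.toPath x) =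
      act K N e.toPath (F x) := by
    have h1 := congrArg (Subtype.val) (LinearMap.congr_fun (congrFun hf ⟨a, b, e⟩)
      ⟨act K X (.nil : Quiver.Path a a) x, act_mem K _ x⟩)
    rw [homDifferential_apply] at h1
    have h2 := sub_eq_zero.1 h1
    rw [← hF, ← hF] at h2
    simp only [act_act_nil] at h2
    rw [h2, hFv, act_act_nil]
  have hF0 := h { F with map_smul' := map_smul_of_arrows K F hFv hFe }
  ext a x
  rw [← hF]
  exact LinearMap.congr_fun hF0 x

/-- The identity family lies in the kernel. -/
theorem ker_homDifferential_ne_bot [Nontrivial X] :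
    LinearMap.ker (homDifferential K (V := V) X X) ≠ ⊥ := by
  intro h
  have h1 : homDifferential K (V := V) X X (fun a => LinearMap.id) = 0 := by
    ext e x
    rw [homDifferential_apply]
    simp
  have h2 := LinearMap.ker_eq_bot'.1 h _ h1
  refine not_subsingleton X (subsingleton_of_forall_eq 0 fun x => ?_)
  rw [← sum_act_nil K (V := V) x]
  refine Finset.sum_eq_zero fun a _ => ?_
  exact congrArg Subtype.val
    (LinearMap.congr_fun (congrFun h2 a) ⟨act K X (.nil : Quiver.Path a a) x, act_mem K _ x⟩)

end VertexSpaces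

variable {X N : Type (max u v w)} [AddCommGroup X] [Module K X] [Module (Opp K V) X]
  [IsScalarTower K (Opp K V) X] [AddCommGroup N] [Module K N] [Module (Opp K V) N]
  [IsScalarTower K (Opp K V) N]

/-- A family on arrows extends to a derivation. If it is inner, given by `f`, then `f` respects the
vertices because the derivation kills trivial paths, and the restrictions of `f` form the required
preimage. -/
theorem homDifferential_surjective (h : ExtVanishes (Opp K V) X N) :
    Function.Surjective (homDifferential K (V := V) X N) := by
  intro G
  let g : ∀ {a b : V}, (a ⟶ b) → X →ₗ[K] N := fun {a b} e =>
    (vertexSpace K N b).subtype ∘ₗ G ⟨a, b, e⟩ ∘ₗ (act K X (.nil : Quiver.Path a a)).rangeRestrict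
  have hg : ∀ {a b : V} (e : a ⟶ b) x, act K N (.nil : Quiver.Path b b) (g e x) = g e x :=
    fun e x => act_nil_of_mem K (Subtype.prop _)
  have hgx {a b : V} (e : a ⟶ b) (x : vertexSpace K X a) : g e x = G ⟨a, b, e⟩ x := by
    have : (act K X (.nil : Quiver.Path a a)).rangeRestrict x = x :=
      Subtype.ext (act_nil_of_mem K x.2)
    simp [g, this]
  obtain ⟨f, hf⟩ := (arrowDerivation K hg).exists_inner h
  have hfv (a : V) (x : X) : f (act K X (.nil : Quiver.Path a a) x) =
      act K N (.nil : Quiver.Path a a) (f x) := by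
    have := hf (MulOpposite.op (of K ⟨a, a, .nil⟩)) x
    rw [arrowDerivation_apply] at this
    exact this.trans (add_zero _)
  have hfe {a b : V} (e : a ⟶ b) (x : vertexSpace K X a) : f (act K X e.toPath x) =
      act K N e.toPath (f x) + G ⟨a, b, e⟩ x := by
    have := hf (MulOpposite.op (of K ⟨a, b, e.toPath⟩)) x
    rw [arrowDerivation_apply] at this
    refine this.trans ?_
    congr 1
    change pathDeriv K g (Quiver.Path.nil.cons e) _ = _
    rw [pathDeriv_cons, act_nil_of_mem K x.2, hgx]
    change act K N e.toPath 0 + _ = _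
    rw [map_zero, zero_add]
  -- Inner derivations are given by additive maps only; linearity over `K` follows since the
  -- derivation kills 1, hence all scalars.
  have hfK (c : K) (x : X) : f (c • x) = c • f x := by
    have := hf (algebraMap K (Opp K V) c) x
    rw [algebraMap_smul, algebraMap_smul] at this
    rw [this, add_eq_left]
    change derivLin K g (algebraMap K (Opp K V) c).unop x = 0
    have h1 : (algebraMap K (Opp K V) c).unop = c • (1 : PathAlgebra K V) := by
      rw [Algebra.algebraMap_eq_smul_one]; rfl
    have h2 : derivLin K g 1 x = 0 := (arrowDerivation K hg).map_one_apply x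
    rw [h1, map_smul, LinearMap.smul_apply, h2, smul_zero]
  let F : X →ₗ[K] N := { f with map_smul' := hfK }
  refine ⟨fun a => F.restrict (p := vertexSpace K X a) (q := vertexSpace K N a) ?_, ?_⟩
  · rintro x hx
    refine ⟨F x, ?_⟩
    exact (hfv a x).symm.trans (congrArg f (act_nil_of_mem K hx))
  · ext e x
    rw [homDifferential_apply]
    exact sub_eq_iff_eq_add'.2 (hfe e.2.2 x)

/-- The linear functional given by the Euler form of the quiver. -/
noncomputable def eulerForm [Fintype (Arrows V)] (x : V → ℚ) : (V → ℚ) →ₗ[ℚ] ℚ :=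
  ∑ a, x a • LinearMap.proj a - ∑ e : Arrows V, x e.1 • LinearMap.proj e.2.1

variable (X) in
/-- The dimension vector of a module. -/
noncomputable def dimVector (a : V) : ℚ := Module.finrank K (vertexSpace K X a)

/-- Rank–nullity for the surjective differential: the dimensions of its source and target are the
vertex and arrow sums of the Euler form. -/
theorem finrank_ker_homDifferential [Fintype (Arrows V)] [Module.Finite K X] [Module.Finite K N]
    (h : ExtVanishes (Opp K V) X N) :
    (Module.finrank K (LinearMap.ker (homDifferential K (V := V) X N)) : ℚ) =
      eulerForm (V := V) (dimVector K X) (dimVector K N) := by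
  have h1 := (homDifferential K (V := V) X N).finrank_range_add_finrank_ker
  rw [LinearMap.range_eq_top.2 (homDifferential_surjective K h), finrank_top,
    Module.finrank_pi_fintype, Module.finrank_pi_fintype] at h1
  simp only [Module.finrank_linearMap] at h1
  have h2 := congrArg (Nat.cast : ℕ → ℚ) h1
  push_cast at h2
  simp only [eulerForm, LinearMap.sub_apply, LinearMap.sum_apply, LinearMap.smul_apply,
    LinearMap.proj_apply, smul_eq_mul, dimVector]
  linarith

end Euler

end

end PathAlgebra

theorem linearIndependent_of_triangular {k E : Type*} [Field k] [AddCommGroup E] [Module k E] {t : ℕ}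
    (x : Fin t → E) (φ : Fin t → E →ₗ[k] k) (h : ∀ i j, i < j → φ j (x i) = 0)
    (h' : ∀ i, φ i (x i) ≠ 0) : LinearIndependent k x := by
  rw [Fintype.linearIndependent_iff]
  intro c hc j
  -- Coefficients are killed from the largest index down; `φ j` already annihilates the vectors of
  -- index below j.
  induction j using WellFoundedGT.induction with
  | ind j ih =>
    have h1 := congrArg (φ j) hc
    rw [map_sum, map_zero, Finset.sum_eq_single j] at h1
    · rw [map_smul, smul_eq_mul] at h1
      exact (mul_eq_zero.1 h1).resolve_right (h' j)
    · intro i _ hij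
      rcases lt_or_gt_of_ne hij with hlt | hgt
      · rw [map_smul, h i j hlt, smul_zero]
      · rw [ih i hgt, zero_smul, map_zero]
    · simp

namespace PathAlgebra

/-- With x_i the dimension vector of `X i`, ⟨x_j, x_i⟩ = dim Hom(X j, X i) = 0 for i < j, while
⟨x_i, x_i⟩ = dim End(X i) ≠ 0. -/
theorem card_le_of_isStratified {K : Type u} [Field K] {V : Type v} [Quiver.{w} V] [Fintype V]
    [Finite (Arrows V)] [Module.Finite K (Opp K V)] {t : ℕ}
    {X : Fin t → ModuleCat.{max u v w} (Opp K V)} (hX : IsStratified X) : t ≤ Fintype.card V := by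
  let _ : ∀ i, Module K (X i) := fun i => Module.compHom (X i) (algebraMap K (Opp K V))
  have : ∀ i, IsScalarTower K (Opp K V) (X i) := fun i => ⟨fun c r x => by
    rw [Algebra.smul_def, mul_smul]; rfl⟩
  have : ∀ i, Module.Finite K (X i) := fun i => by
    have := hX.finite i
    exact Module.Finite.trans (Opp K V) (X i)
  let _ : Fintype (Arrows V) := Fintype.ofFinite _
  have hli := linearIndependent_of_triangular (k := ℚ) (fun i => dimVector K (V := V) (X i))
    (fun j => eulerForm (V := V) (dimVector K (X j))) (fun i j hij => ?_) fun i => ?_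
  · simpa using hli.fintype_card_le_finrank
  · rw [← finrank_ker_homDifferential K (hX.ext_eq_zero i j hij.le),
      ker_homDifferential_eq_bot K (hX.hom_eq_zero i j hij), finrank_bot, Nat.cast_zero]
  · have := (hX.indecomposable i).nontrivial
    rw [← finrank_ker_homDifferential K (hX.ext_eq_zero i i le_rfl), Nat.cast_ne_zero]
    intro h
    exact ker_homDifferential_ne_bot K (V := V) (X := X i) (Submodule.finrank_eq_zero.1 h)

end PathAlgebra

/-! ### Path algebras are hereditary. -/

namespace PathAlgebra

section Hereditary

variable (K : Type u) [Field K] {V : Type v} [Quiver.{w} V] [Fintype V]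

/-- Every surjection onto the kernel of a map from a projective module splits. -/
theorem exists_section_of_isShortExact {Ω P T N : Type*} [AddCommGroup Ω] [Module K Ω]
    [Module (Opp K V) Ω] [IsScalarTower K (Opp K V) Ω] [AddCommGroup P] [Module K P]
    [Module (Opp K V) P] [IsScalarTower K (Opp K V) P] [AddCommGroup T] [Module K T]
    [Module (Opp K V) T] [IsScalarTower K (Opp K V) T] [AddCommGroup N] [Module K N]
    [Module (Opp K V) N] [IsScalarTower K (Opp K V) N] [Module.Projective (Opp K V) P]
    {i : Ω →ₗ[Opp K V] P} {π : P →ₗ[Opp K V] T} (hs : IsShortExact i π)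
    (ρ : N →ₗ[Opp K V] Ω) (hρ : Function.Surjective ρ) :
    ∃ h : Ω →ₗ[Opp K V] N, ρ ∘ₗ h = LinearMap.id := by
  have hsK : IsShortExact (i.restrictScalars K) (π.restrictScalars K) :=
    ⟨hs.injective, hs.exact, hs.surjective⟩
  obtain ⟨s₀, hs₀⟩ := (π.restrictScalars K).exists_rightInverse_of_surjective
    (LinearMap.range_eq_top.2 hs.surjective)
  obtain ⟨σ, hσ⟩ := (ρ.restrictScalars K).exists_rightInverse_of_surjective
    (LinearMap.range_eq_top.2 hρ)
  have hs₀' (x : T) : π (s₀ x) = x := LinearMap.congr_fun hs₀ x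
  have hσ' (x : Ω) : ρ (σ x) = x := LinearMap.congr_fun hσ x
  -- The section of `π` is made compatible with trivial paths, so that its cocycle r ↦ r s − s r
  -- vanishes on them and is determined by the arrows.
  let s : T →ₗ[K] P := ∑ a : V, act K P (.nil : Quiver.Path a a) ∘ₗ s₀ ∘ₗ
    act K T (.nil : Quiver.Path a a)
  have hs_apply (x : T) : s x = ∑ a : V, act K P (.nil : Quiver.Path a a)
      (s₀ (act K T (.nil : Quiver.Path a a) x)) := by
    rw [LinearMap.sum_apply]; rfl
  have hπs (x : T) : π (s x) = x := by
    rw [hs_apply, map_sum]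
    conv_rhs => rw [← sum_act_nil K (V := V) x]
    refine Finset.sum_congr rfl fun a _ => ?_
    rw [act_map, hs₀', act_act_nil]
  have hsv (a : V) (x : T) : s (act K T (.nil : Quiver.Path a a) x) =
      act K P (.nil : Quiver.Path a a) (s x) := by
    rw [hs_apply, hs_apply, map_sum]
    refine Finset.sum_congr rfl fun b _ => ?_
    by_cases h : b = a
    · subst h
      rw [act_act_nil, act_act_nil]
    · rw [act_act_of_ne K _ _ h, act_act_of_ne K _ _ (Ne.symm h), map_zero, map_zero]
  have hγ : ∀ (a b : V) (e : a ⟶ b), ∃ γ : T →ₗ[K] Ω,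
      ∀ x, i (γ x) = act K P e.toPath (s x) - s (act K T e.toPath x) := by
    intro a b e
    obtain ⟨γ, hγ⟩ := hsK.exists_lift (act K P e.toPath ∘ₗ s - s ∘ₗ act K T e.toPath) (by
      ext x
      change π (act K P e.toPath (s x) - s (act K T e.toPath x)) = 0
      rw [map_sub, act_map, hπs, hπs, sub_self])
    exact ⟨γ, fun x => LinearMap.congr_fun hγ x⟩
  choose γ hγ using hγ
  -- The cocycle of `s` is lifted through `ρ` on arrows only; the derivation generated by the lift
  -- then lifts the whole cocycle (`hir`).
  let g : ∀ {a b : V}, (a ⟶ b) → T →ₗ[K] N := fun {a b} e =>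
    act K N (.nil : Quiver.Path b b) ∘ₗ σ ∘ₗ γ a b e
  have hg : ∀ {a b : V} (e : a ⟶ b) x, act K N (.nil : Quiver.Path b b) (g e x) = g e x :=
    fun e x => act_nil_act K _ _
  have hig {a b : V} (e : a ⟶ b) (x : T) :
      i (ρ (g e x)) = act K P e.toPath (s x) - s (act K T e.toPath x) := by
    change i (ρ (act K N (.nil : Quiver.Path b b) (σ (γ a b e x)))) = _
    rw [act_map, hσ', act_map, hγ, map_sub, act_nil_act, ← hsv, act_nil_act]
  have hip {a b : V} (p : Quiver.Path a b) (x : T) :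
      i (ρ (pathDeriv K g p x)) = act K P p (s x) - s (act K T p x) := by
    induction p with
    | nil =>
      rw [hsv, sub_self]
      change i (ρ 0) = 0
      rw [map_zero, map_zero]
    | cons p e ih =>
      rw [pathDeriv_cons, map_add, map_add, hig, act_map, act_map, ih, map_sub, act_cons, act_cons]
      abel
  have hir (r : Opp K V) (x : T) :
      i (ρ ((arrowDerivation K hg).toFun r x)) = r • s x - s (r • x) := by
    obtain ⟨r, rfl⟩ := MulOpposite.op_surjective r
    induction r using induction_on with
    | zero => simp
    | add r r' hr hr' =>
      rw [MulOpposite.op_add, map_add, AddMonoidHom.add_apply, map_add, map_add, hr, hr', add_smul,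
        add_smul, map_add]
      abel
    | smul_of c y =>
      have h1 (z : N) : i (ρ (c • z)) = c • i (ρ z) := ((i ∘ₗ ρ).restrictScalars K).map_smul c z
      rw [arrowDerivation_smul, op_smul_of_smul, op_smul_of_smul, h1, hip, s.map_smul, smul_sub]
  obtain ⟨h, hh⟩ := (arrowDerivation K hg).exists_inner_of_projective π
  obtain ⟨q, hq⟩ := hsK.exists_lift (LinearMap.id - s ∘ₗ π.restrictScalars K) (by
    ext x
    change π (x - s (π x)) = 0
    rw [map_sub, hπs, sub_self])
  have hq' (x : P) : i (q x) = x - s (π x) := LinearMap.congr_fun hq x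
  -- `ρ ∘ h` and the `K`-linear projection `q` of `P` onto `Ω` fail to be module homomorphisms by
  -- the same cocycle, so their difference is one and lifts through `ρ`.
  let k₀ : P →ₗ[Opp K V] Ω :=
    { toFun := fun x => ρ (h x) - q x
      map_add' := fun x y => by rw [map_add, map_add, map_add]; abel
      map_smul' := fun r x => hs.injective (by
        have h1 (z : N) : i (ρ (r • z)) = r • i (ρ z) := (i ∘ₗ ρ).map_smul r z
        rw [RingHom.id_apply, map_sub, hh, map_add, map_add, hir, hq', π.map_smul, i.map_smul, h1,
          map_sub, hq', smul_sub, smul_sub]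
        abel) }
  obtain ⟨k, hk⟩ := Module.projective_lifting_property ρ k₀ hρ
  have hk' (x : P) : ρ (k x) = ρ (h x) - q x := LinearMap.congr_fun hk x
  have hπi (x : Ω) : π (i x) = 0 := hs.exact.apply_apply_eq_zero x
  -- On `Ω` the derivation term disappears because `π ∘ i = 0`, so `h` is linear there, and ρ(h − k)
  -- = q restricts to the identity.
  refine ⟨{ toFun := fun x => h (i x) - k (i x)
            map_add' := fun x y => by rw [map_add, map_add, map_add]; abel
            map_smul' := fun r x => by
              rw [map_smul, hh, hπi, map_zero, add_zero, map_smul, RingHom.id_apply, smul_sub] },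
    ?_⟩
  ext x
  change ρ (h (i x) - k (i x)) = x
  rw [map_sub, hk', sub_sub_cancel]
  exact hs.injective (by rw [hq', hπi, map_zero, sub_zero])

theorem hasProjectiveDimensionLE_one (T : ModuleCat.{max u v w} (Opp K V)) :
    HasProjectiveDimensionLE T 1 := by
  let _ : Module K T := Module.compHom T (algebraMap K (Opp K V))
  have : IsScalarTower K (Opp K V) T := ⟨fun c r x => by
    rw [Algebra.smul_def, mul_smul]; rfl⟩
  let π : (T →₀ Opp K V) →ₗ[Opp K V] T := Finsupp.linearCombination (Opp K V) id
  have hs := isShortExact_ker π (Finsupp.linearCombination_id_surjective (Opp K V) T)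
  have hΩ : Module.Projective (Opp K V) (LinearMap.ker π) :=
    Module.Projective.of_lifting_property'' fun f hf =>
      exists_section_of_isShortExact K hs f hf
  have h1 : Projective (ModuleCat.of (Opp K V) (LinearMap.ker π)) :=
    (IsProjective.iff_projective _).1 hΩ
  have h2 : Projective (ModuleCat.of (Opp K V) (T →₀ Opp K V)) :=
    (IsProjective.iff_projective _).1 inferInstance
  exact (hs.shortExact.hasProjectiveDimensionLT_X₃_iff 0 h2).2
    (projective_iff_hasProjectiveDimensionLT_one.1 h1)

end Hereditary

/-! ### Finite dimension of the path algebra of an acyclic quiver. -/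

section Finiteness

variable {V : Type v} [Quiver.{w} V] [Finite V] [∀ a b : V, Finite (a ⟶ b)]

/-- Acyclicity makes "joined by a path of positive length" a strict order on a finite set, hence
well founded. Induction on the target vertex applies: a nontrivial path is an arrow appended to a
path ending at an earlier vertex. -/
theorem finite_quiverPaths (h : QuiverAcyclic V) : Finite (QuiverPaths V) := by
  let r : V → V → Prop := fun a b => ∃ p : Quiver.Path a b, 0 < p.length
  have : IsTrans V r := ⟨fun a b c ⟨p, hp⟩ ⟨q, _⟩ => ⟨p.comp q, by
    rw [Quiver.Path.length_comp]; omega⟩⟩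
  have : Std.Irrefl r := ⟨fun a ⟨p, hp⟩ => hp.ne' (h a p)⟩
  have hwf : WellFounded r := Finite.wellFounded_of_trans_of_irrefl r
  have key : ∀ b : V, Finite (Σ a : V, Quiver.Path a b) := by
    intro b
    induction b using hwf.induction with
    | _ b ih =>
      have hfin : ∀ c : V, Finite ((c ⟶ b) × Σ a : V, Quiver.Path a c) := by
        intro c
        rcases isEmpty_or_nonempty (c ⟶ b) with he | ⟨⟨e⟩⟩
        · infer_instance
        · have := ih c ⟨e.toPath, Nat.one_pos⟩
          infer_instance
      let F : Option (Σ c : V, (c ⟶ b) × Σ a : V, Quiver.Path a c) → Σ a : V, Quiver.Path a b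
        | none => ⟨b, .nil⟩
        | some ⟨_, e, a, p⟩ => ⟨a, p.cons e⟩
      refine Finite.of_surjective F ?_
      rintro ⟨a, p⟩
      cases p with
      | nil => exact ⟨none, rfl⟩
      | cons p e => exact ⟨some ⟨_, e, _, p⟩, rfl⟩
  let G : (Σ b : V, Σ a : V, Quiver.Path a b) → QuiverPaths V := fun x => ⟨x.2.1, x.1, x.2.2⟩
  exact Finite.of_surjective G fun ⟨a, b, p⟩ => ⟨⟨b, a, p⟩, rfl⟩

theorem finite_opp (K : Type u) [Field K] {V : Type v} [Quiver.{w} V] [Fintype V]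
    [∀ a b : V, Finite (a ⟶ b)] (h : QuiverAcyclic V) : Module.Finite K (Opp K V) := by
  have := finite_quiverPaths h
  have : Module.Finite K (PathAlgebra K V) :=
    inferInstanceAs (Module.Finite K (QuiverPaths V →₀ K))
  exact Module.Finite.equiv (MulOpposite.opLinearEquiv K)

end Finiteness

end PathAlgebra

theorem mainTheorem7
    {K : Type u} [Field K] [IsAlgClosed K]
    {Q : Type v} [Quiver.{w} Q] [Fintype Q] [∀ a b : Q, Finite (a ⟶ b)]
    (hconn : QuiverConnected Q) (hacyc : QuiverAcyclic Q)
    (n : ℕ) (hn : Fintype.card Q = n)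
    (t : ℕ) (X : Fin t → RightPathModule K Q) (hX : IsStratifyingSystem X) :
    (∃ T : RightPathModule K Q, IsPartialTilting T ∧ IsBasicModule T ∧
      ∀ M : RightPathModule K Q, (IsFilteredBy X M ∧ IsExtInjectiveFor X M) ↔ InAdd T M) ∧
    t ≤ n := by
  have := PathAlgebra.finite_opp K hacyc
  have hX' := hX.isStratified
  refine ⟨?_, hn ▸ PathAlgebra.card_le_of_isStratified hX'⟩
  obtain ⟨T, hfin, hext, hbasic, hT⟩ := hX'.exists_basic K
  exact ⟨T, ⟨hfin, PathAlgebra.hasProjectiveDimensionLE_one K T, hext⟩, hbasic, hT⟩
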